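/- Let $\mathbb M_2$ be the algebra of complex $2\times2$ matrices, $\mathcal R=\bigotimes_{i\in\mathbb Z}\mathbb M_2$ the CAR algebra (one qubit at each site $i\in\mathbb Z$), and $\mathcal A=\mathcal B=\bigotimes_{q\in\mathbb Q^+}\mathcal R$ (one register $\mathcal R$ for each positive rational $q$); all tensor products are maximal C*-tensor products, infinite ones being inductive limits of finite ones. For $q\in\mathbb Q^+$ let $|\phi_q\rangle=q_0|00\rangle+q_1|11\rangle$ with $q_0,q_1>0$, $q_0^2+q_1^2=1$ and $q_0^2/q_1^2=q$. **States.** For each $q\in\mathbb Q^+$ there is a state $s_q$ of $\mathcal R\otimes\mathcal R$ with $$s_q\Big(\bigotimes_i a_i\otimes\bigotimes_i b_i\Big)=\prod_{i\le 0}\langle 00|a_i\otimes b_i|00\rangle\prod_{i\ge 1}\langle\phi_q|a_i\otimes b_i|\phi_q\rangle$$ (with $a_i=b_i=1$ for all but finitely many $i$), and there is a single catalyst state $s$ of $\mathcal A\otimes\mathcal B$ with $s\big(\bigotimes_q x_q\otimes\bigotimes_q y_q\big)=\prod_q s_q(x_q\otimes y_q)$ (with $x_q=y_q=1$ for all but finitely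 many $q$). **Local automorphisms.** For each $q\in\mathbb Q^+$ there are a *-automorphism $\alpha_{q,\mathrm{swap}}$ of $\mathcal A\otimes\mathbb M_2$ which exchanges the qubit at site $0$ of register $q$ with the outside qubit $\mathbb M_2$ and fixes all other qubits, and a *-automorphism $\alpha_{q,\pi}$ of $\mathcal A$ which moves the observables at site $i$ of register $q$ to site $i+1$, for all $i$, and is the identity on the other registers; and $\alpha_q=(\alpha_{q,\pi}\otimes\mathrm{id})\circ\alpha_{q,\mathrm{swap}}$ is a *-automorphism of $\mathcal A\otimes\mathbb M_2$. For each unitary $U\in\mathbb M_2$ there is a *-automorphism $\rho_U$ of $\mathcal A\otimes\mathbb M_2$ with $\rho_U(a\otimes m)=a\otimes U^*mU$. **Exact embezzlement.** Let $s_0(m)=\langle0|m|0\rangle$ and $s_\phi(M)=\langle\phi|M|\phi\rangle$. For all $q\in\mathbb Q^+$, $$(s\otimes s_0\otimes s_0)\big((\alpha_q\otimes\alpha_q)(X)\big)=(s\otimes s_{\phi_q})(X)\qquad\text{for all }X\in\mathcal A\otimes\mathcal B\otimes\mathbb M_2\otimes\mathbb M_2$$ (up to the evident reordering of tensor factors).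 More generally, for all unitaries $U,V\in\mathbb M_2$ the same holds with the local automorphisms $\alpha_q\circ\rho_U$ and $\alpha_q\circ\rho_V$ of the two parties and the target state $(U\otimes V)|\phi_q\rangle$. **Density.** All the states $(U\otimes V)|\phi_q\rangle$ ($q\in\mathbb Q^+$, $U,V$ unitary) are entangled, and they are dense in the set of all unit vectors of $\mathbb C^2\otimes\mathbb C^2$; in particular they are dense in the set of entangled two-qubit states. -/

import Mathlib

namespace CStarEmbezzlement

universe u

/-! ### The universal C*-algebra of a *-algebra subject to relations -/

section Universal

variable {P : Type u} [Ring P] [StarRing P] [Algebra ℂ P]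

/-- The norms `‖π x‖`, where `π` runs through the unital *-homomorphisms from the *-algebra `P` to
unital C*-algebras that respect the relations `r`. (By the Gelfand-Naimark theorem it makes no
difference whether the targets are all C*-algebras or only the algebras `B(H)`; the closure of the
image of `P` always lives in the universe of `P`, so the universe is no restriction.) -/
def repNorms (r : P → P → Prop) (x : P) : Set ℝ :=
  {c | ∃ (D : Type u) (_ : CStarAlgebra D) (π : P →⋆ₐ[ℂ] D),
    (∀ a b, r a b → π a = π b) ∧ c = ‖π x‖}

/-- The universal C*-seminorm of `P` subject to the relations `r` is finite. -/
class HasUniversalNorm (r : P → P → Prop) : Prop where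
  bddAbove : ∀ x : P, BddAbove (repNorms r x)

/-- A copy of `P`, to carry the universal C*-seminorm. -/
def PreUniversal (_r : P → P → Prop) : Type u := P

namespace PreUniversal

variable (r : P → P → Prop)

instance : Ring (PreUniversal r) := inferInstanceAs (Ring P)
instance : StarRing (PreUniversal r) := inferInstanceAs (StarRing P)
instance : Algebra ℂ (PreUniversal r) := inferInstanceAs (Algebra ℂ P)
instance [StarModule ℂ P] : StarModule ℂ (PreUniversal r) := inferInstanceAs (StarModule ℂ P)

/-- The identity map from `P` to its copy. -/
def ofAlg : P →⋆ₐ[ℂ] PreUniversal r where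
  toFun x := x
  map_one' := rfl
  map_mul' _ _ := rfl
  map_zero' := rfl
  map_add' _ _ := rfl
  commutes' _ := rfl
  map_star' _ := rfl

/-- The identity map from the copy of `P` back to `P`. -/
def toAlg : PreUniversal r →⋆ₐ[ℂ] P where
  toFun x := x
  map_one' := rfl
  map_mul' _ _ := rfl
  map_zero' := rfl
  map_add' _ _ := rfl
  commutes' _ := rfl
  map_star' _ := rfl

/-- The universal C*-seminorm: the supremum of the norms in all representations. -/
noncomputable instance : Norm (PreUniversal r) := ⟨fun x => sSup (repNorms r (toAlg r x))⟩

variable {r}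

theorem norm_le {x : PreUniversal r} {c : ℝ} (hc : 0 ≤ c)
    (h : ∀ (D : Type u) (_ : CStarAlgebra D) (π : PreUniversal r →⋆ₐ[ℂ] D),
      (∀ a b : P, r a b → π (ofAlg r a) = π (ofAlg r b)) → ‖π x‖ ≤ c) : ‖x‖ ≤ c := by
  refine Real.sSup_le ?_ hc
  rintro _ ⟨D, hD, π, hπ, rfl⟩
  exact h D hD (π.comp (toAlg r)) hπ

theorem norm_nonneg' (x : PreUniversal r) : 0 ≤ ‖x‖ := by
  refine Real.sSup_nonneg ?_
  rintro _ ⟨D, hD, π, hπ, rfl⟩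
  exact norm_nonneg _

theorem norm_zero' : ‖(0 : PreUniversal r)‖ = 0 :=
  le_antisymm (norm_le le_rfl fun D hD π hπ => by simp) (norm_nonneg' _)

variable [HasUniversalNorm r]

theorem le_norm {D : Type u} [hD : CStarAlgebra D] (π : PreUniversal r →⋆ₐ[ℂ] D)
    (hπ : ∀ a b : P, r a b → π (ofAlg r a) = π (ofAlg r b)) (x : PreUniversal r) :
    ‖π x‖ ≤ ‖x‖ :=
  le_csSup (HasUniversalNorm.bddAbove (r := r) (toAlg r x)) ⟨D, hD, π.comp (ofAlg r), hπ, rfl⟩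

theorem norm_smul_le' (c : ℂ) (x : PreUniversal r) : ‖c • x‖ ≤ ‖c‖ * ‖x‖ := by
  refine norm_le (mul_nonneg (norm_nonneg c) (norm_nonneg' x)) fun D hD π hπ => ?_
  rw [map_smul, norm_smul]
  gcongr
  exact le_norm π hπ x

theorem norm_mul_le' (x y : PreUniversal r) : ‖x * y‖ ≤ ‖x‖ * ‖y‖ := by
  refine norm_le (mul_nonneg (norm_nonneg' x) (norm_nonneg' y)) fun D hD π hπ => ?_
  rw [map_mul]
  refine (norm_mul_le _ _).trans ?_
  gcongr
  · exact norm_nonneg' x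
  · exact le_norm π hπ x
  · exact le_norm π hπ y

theorem norm_add_le' (x y : PreUniversal r) : ‖x + y‖ ≤ ‖x‖ + ‖y‖ := by
  refine norm_le (add_nonneg (norm_nonneg' x) (norm_nonneg' y)) fun D hD π hπ => ?_
  rw [map_add]
  exact (norm_add_le _ _).trans (add_le_add (le_norm π hπ x) (le_norm π hπ y))

theorem norm_star_le' (x : PreUniversal r) : ‖star x‖ ≤ ‖x‖ := by
  refine norm_le (norm_nonneg' x) fun D hD π hπ => ?_
  rw [map_star, norm_star]
  exact le_norm π hπ x

theorem norm_mul_self_le' (x : PreUniversal r) : ‖x‖ * ‖x‖ ≤ ‖star x * x‖ := by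
  have : ‖x‖ ≤ Real.sqrt ‖star x * x‖ := by
    refine norm_le (Real.sqrt_nonneg _) fun D hD π hπ => Real.le_sqrt_of_sq_le ?_
    calc ‖π x‖ ^ 2 = ‖π (star x * x)‖ := by
          rw [map_mul, map_star, CStarRing.norm_star_mul_self, sq]
      _ ≤ _ := le_norm π hπ _
  calc ‖x‖ * ‖x‖ ≤ Real.sqrt ‖star x * x‖ * Real.sqrt ‖star x * x‖ :=
        mul_self_le_mul_self (norm_nonneg' x) this
    _ = _ := Real.mul_self_sqrt (norm_nonneg' _)

theorem seminormCore : SeminormedSpace.Core ℂ (PreUniversal r) where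
  norm_nonneg := norm_nonneg'
  norm_smul c x := by
    refine le_antisymm (norm_smul_le' c x) ?_
    rcases eq_or_ne c 0 with rfl | hc
    · simpa using norm_nonneg' ((0 : ℂ) • x)
    · have h := norm_smul_le' c⁻¹ (c • x)
      rw [smul_smul, inv_mul_cancel₀ hc, one_smul, norm_inv] at h
      have hc' : 0 < ‖c‖ := norm_pos_iff.mpr hc
      rwa [← div_eq_inv_mul, le_div_iff₀ hc', mul_comm] at h
  norm_triangle := norm_add_le'

noncomputable instance : SeminormedRing (PreUniversal r) where
  __ := (inferInstance : Ring (PreUniversal r))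
  __ := SeminormedAddCommGroup.ofCore (seminormCore (r := r))
  norm_mul_le := norm_mul_le'

noncomputable instance : NormedAlgebra ℂ (PreUniversal r) where
  norm_smul_le := norm_smul_le'

instance : NormedStarGroup (PreUniversal r) where
  norm_star_le := norm_star_le'

end PreUniversal

/-- The universal C*-algebra of the *-algebra `P` subject to the relations `r`: the
(Hausdorff) completion of `P` in the universal C*-seminorm. -/
def Universal (r : P → P → Prop) [HasUniversalNorm r] : Type u :=
  UniformSpace.Completion (PreUniversal r)

namespace Universal

open UniformSpace

variable (r : P → P → Prop) [HasUniversalNorm r]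

noncomputable instance : NormedRing (Universal r) :=
  inferInstanceAs (NormedRing (Completion (PreUniversal r)))

instance : CompleteSpace (Universal r) :=
  inferInstanceAs (CompleteSpace (Completion (PreUniversal r)))

noncomputable instance : Algebra ℂ (Universal r) :=
  inferInstanceAs (Algebra ℂ (Completion (PreUniversal r)))

/-- The canonical map from `P` to its universal C*-algebra. -/
noncomputable def coe : PreUniversal r → Universal r := fun x => (x : Completion (PreUniversal r))

variable {r}

@[elab_as_elim]
theorem induction {p : Universal r → Prop} (x : Universal r) (hc : IsClosed {a | p a})
    (h : ∀ a, p (coe r a)) : p x :=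
  Completion.induction_on x hc h

@[elab_as_elim]
theorem induction₂ {p : Universal r → Universal r → Prop} (x y : Universal r)
    (hc : IsClosed {a : Universal r × Universal r | p a.1 a.2})
    (h : ∀ a b, p (coe r a) (coe r b)) : p x y :=
  Completion.induction_on₂ x y hc h

theorem continuous_coe : Continuous (coe r) := Completion.continuous_coe _
theorem coe_add (a b : PreUniversal r) : coe r (a + b) = coe r a + coe r b :=
  Completion.coe_add a b
theorem coe_mul (a b : PreUniversal r) : coe r (a * b) = coe r a * coe r b :=
  Completion.coe_mul a b
theorem coe_one : coe r 1 = 1 := Completion.coe_one _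
theorem coe_zero : coe r 0 = 0 := Completion.coe_zero
theorem coe_smul (c : ℂ) (a : PreUniversal r) : coe r (c • a) = c • coe r a :=
  Completion.coe_smul c a
theorem norm_coe (a : PreUniversal r) : ‖coe r a‖ = ‖a‖ := Completion.norm_coe a
theorem coe_algebraMap (c : ℂ) : coe r (algebraMap ℂ _ c) = algebraMap ℂ _ c := rfl

variable (r)

noncomputable instance : NormedAlgebra ℂ (Universal r) where
  norm_smul_le c x := norm_smul_le (α := ℂ) (β := Completion (PreUniversal r)) c x

noncomputable instance : Star (Universal r) :=
  ⟨Completion.map (star : PreUniversal r → PreUniversal r)⟩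

variable {r}

theorem star_coe (a : PreUniversal r) : star (coe r a) = coe r (star a) :=
  Completion.map_coe (starNormedAddGroupHom (E := PreUniversal r)).uniformContinuous a

theorem continuous_star' : Continuous (star : Universal r → Universal r) :=
  Completion.continuous_map

variable (r)

instance : ContinuousStar (Universal r) := ⟨continuous_star'⟩

noncomputable instance : StarRing (Universal r) where
  star_involutive x := by
    induction x using Universal.induction with
    | hc => exact isClosed_eq (by fun_prop) (by fun_prop)
    | h a =>
      rw [star_coe, star_coe, star_star]
  star_mul x y := by
    induction x, y using Universal.induction₂ with
    | hc => exact isClosed_eq (by fun_prop) (by fun_prop)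
    | h a b =>
      rw [← coe_mul, star_coe, star_coe, star_coe, star_mul, coe_mul]
  star_add x y := by
    induction x, y using Universal.induction₂ with
    | hc => exact isClosed_eq (by fun_prop) (by fun_prop)
    | h a b =>
      rw [← coe_add, star_coe, star_coe, star_coe, star_add, coe_add]

instance : CStarRing (Universal r) where
  norm_mul_self_le x := by
    induction x using Universal.induction with
    | hc => exact isClosed_le (by fun_prop) (by fun_prop)
    | h a =>
      rw [star_coe, ← coe_mul, norm_coe, norm_coe]
      exact PreUniversal.norm_mul_self_le' a

section

variable [StarModule ℂ P]

instance : StarModule ℂ (Universal r) where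
  star_smul c x := by
    have h1 : Continuous fun x : Universal r => star (c • x) :=
      continuous_star'.comp (continuous_const_smul c)
    have h2 : Continuous fun x : Universal r => star c • star x :=
      continuous_star'.const_smul (star c)
    induction x using Universal.induction with
    | hc => exact isClosed_eq h1 h2
    | h a => rw [← coe_smul, star_coe, star_coe, star_smul, coe_smul]

noncomputable instance : CStarAlgebra (Universal r) where

end

/-- The canonical *-homomorphism from `P` to its universal C*-algebra. -/
noncomputable def of [StarModule ℂ P] : P →⋆ₐ[ℂ] Universal r where
  toFun x := coe r (PreUniversal.ofAlg r x)
  map_one' := coe_one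
  map_mul' _ _ := coe_mul _ _
  map_zero' := coe_zero
  map_add' _ _ := coe_add _ _
  commutes' _ := rfl
  map_star' x := (star_coe (PreUniversal.ofAlg r x)).symm

variable {r}

section Lift

variable {D : Type u} [CStarAlgebra D] (π : P →⋆ₐ[ℂ] D)

/-- The continuous extension of a *-homomorphism on `P` to the universal C*-algebra. -/
noncomputable def liftFun (r : P → P → Prop) [HasUniversalNorm r] : Universal r → D :=
  Completion.extension fun a : PreUniversal r => π (PreUniversal.toAlg r a)

theorem continuous_liftFun : Continuous (liftFun π r) := Completion.continuous_extension

theorem liftFun_coe (hπ : ∀ a b, r a b → π a = π b) 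
    (a : PreUniversal r) : liftFun π r (coe r a) = π (PreUniversal.toAlg r a) := by
  refine Completion.extension_coe ?_ a
  exact uniformContinuous_addMonoidHom_of_continuous
    (f := (π.comp (PreUniversal.toAlg r) : PreUniversal r →⋆ₐ[ℂ] D))
    (AddMonoidHomClass.continuous_of_bound _ 1 fun x => by
      simpa using PreUniversal.le_norm (π.comp (PreUniversal.toAlg r)) hπ x)

/-- The universal property: a *-homomorphism from `P` to a C*-algebra that respects the relations
extends to the universal C*-algebra. -/
noncomputable def lift (hπ : ∀ a b, r a b → π a = π b) :
    Universal r →⋆ₐ[ℂ] D where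
  toFun := liftFun π r
  map_one' := by rw [← coe_one, liftFun_coe π hπ, map_one, map_one]
  map_mul' x y := by
    have hc := continuous_liftFun (r := r) π
    induction x, y using Universal.induction₂ with
    | hc => exact isClosed_eq (by fun_prop) (by fun_prop)
    | h a b =>
      rw [← coe_mul, liftFun_coe π hπ, liftFun_coe π hπ, liftFun_coe π hπ, map_mul, map_mul]
  map_zero' := by rw [← coe_zero, liftFun_coe π hπ, map_zero, map_zero]
  map_add' x y := by
    have hc := continuous_liftFun (r := r) π
    induction x, y using Universal.induction₂ with
    | hc => exact isClosed_eq (by fun_prop) (by fun_prop)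
    | h a b =>
      rw [← coe_add, liftFun_coe π hπ, liftFun_coe π hπ, liftFun_coe π hπ, map_add, map_add]
  commutes' c := by
    rw [← coe_algebraMap, liftFun_coe π hπ]
    simp only [AlgHomClass.commutes]
  map_star' x := by
    have hc := continuous_liftFun (r := r) π
    induction x using Universal.induction with
    | hc => exact isClosed_eq (by fun_prop) (by fun_prop)
    | h a =>
      rw [star_coe, liftFun_coe π hπ, liftFun_coe π hπ, map_star, map_star]

theorem lift_of [StarModule ℂ P] (hπ : ∀ a b, r a b → π a = π b) (x : P) : lift π hπ (of r x) = π x := liftFun_coe π hπ _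

end Lift

end Universal

end Universal

/-! ### The maximal tensor product of two C*-algebras -/

section MaxTensor

open scoped TensorProduct

variable (A B : Type u) [CStarAlgebra A] [CStarAlgebra B]

/-- No relations. -/
def NoRel (P : Type u) : P → P → Prop := fun _ _ => False

instance : HasUniversalNorm (NoRel (A ⊗[ℂ] B)) where
  bddAbove x := by
    induction x with
    | zero => exact ⟨0, by rintro _ ⟨D, hD, π, -, rfl⟩; simp⟩
    | tmul a b =>
      refine ⟨‖a‖ * ‖b‖, ?_⟩
      rintro _ ⟨D, hD, π, -, rfl⟩
      let f : A →⋆ₐ[ℂ] D :=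
        { (π : A ⊗[ℂ] B →ₐ[ℂ] D).comp Algebra.TensorProduct.includeLeft with
          map_star' := fun a => by
            change π (star a ⊗ₜ 1) = star (π (a ⊗ₜ 1))
            rw [← map_star, TensorProduct.star_tmul, star_one] }
      let g : B →⋆ₐ[ℂ] D :=
        { (π : A ⊗[ℂ] B →ₐ[ℂ] D).comp Algebra.TensorProduct.includeRight with
          map_star' := fun b => by
            change π (1 ⊗ₜ star b) = star (π (1 ⊗ₜ b))
            rw [← map_star, TensorProduct.star_tmul, star_one] }
      have h : π (a ⊗ₜ b) = f a * g b := by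
        change π (a ⊗ₜ b) = π (a ⊗ₜ 1) * π (1 ⊗ₜ b)
        rw [← map_mul, Algebra.TensorProduct.tmul_mul_tmul, mul_one, one_mul]
      rw [h]
      refine (norm_mul_le _ _).trans ?_
      gcongr
      · exact NonUnitalStarAlgHom.norm_apply_le f a
      · exact NonUnitalStarAlgHom.norm_apply_le g b
    | add x y hx hy =>
      obtain ⟨c, hc⟩ := hx
      obtain ⟨d, hd⟩ := hy
      refine ⟨c + d, ?_⟩
      rintro _ ⟨D, hD, π, hπ, rfl⟩
      rw [map_add]
      exact (norm_add_le _ _).trans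
        (add_le_add (hc ⟨D, hD, π, hπ, rfl⟩) (hd ⟨D, hD, π, hπ, rfl⟩))

/-- The maximal C*-tensor product: the completion of the algebraic tensor product in the supremum
of the seminorms that come from its *-representations. -/
abbrev MaxTensor : Type u := Universal (NoRel (A ⊗[ℂ] B))

variable {A B}

/-- The elementary tensor `a ⊗ b` in the maximal tensor product. -/
noncomputable def tmul (a : A) (b : B) : MaxTensor A B := Universal.of _ (a ⊗ₜ[ℂ] b)

variable {A' B' : Type u} [CStarAlgebra A'] [CStarAlgebra B']

/-- The algebraic tensor product of two *-homomorphisms. -/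
noncomputable def algMap (f : A →⋆ₐ[ℂ] A') (g : B →⋆ₐ[ℂ] B') : A ⊗[ℂ] B →⋆ₐ[ℂ] A' ⊗[ℂ] B' :=
  { Algebra.TensorProduct.map (f : A →ₐ[ℂ] A') (g : B →ₐ[ℂ] B') with
    map_star' := fun x => by
      change Algebra.TensorProduct.map (f : A →ₐ[ℂ] A') (g : B →ₐ[ℂ] B') (star x) =
        star (Algebra.TensorProduct.map (f : A →ₐ[ℂ] A') (g : B →ₐ[ℂ] B') x)
      induction x with
      | zero => simp
      | tmul a b => simp [map_star]
      | add x y hx hy => rw [star_add, map_add, map_add, star_add, hx, hy] }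

/-- The tensor product `f ⊗ g` of two *-homomorphisms on the maximal tensor product. -/
noncomputable def tensorMap (f : A →⋆ₐ[ℂ] A') (g : B →⋆ₐ[ℂ] B') :
    MaxTensor A B →⋆ₐ[ℂ] MaxTensor A' B' :=
  Universal.lift ((Universal.of (NoRel (A' ⊗[ℂ] B'))).comp (algMap f g)) fun _ _ h => h.elim

theorem tensorMap_tmul (f : A →⋆ₐ[ℂ] A') (g : B →⋆ₐ[ℂ] B') (a : A) (b : B) :
    tensorMap f g (tmul a b) = tmul (f a) (g b) :=
  Universal.lift_of _ _ _

end MaxTensor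

/-! ### Infinite tensor products of C*-algebras -/

section InfTensor

variable {ι : Type u} (A : ι → Type u) [∀ i, CStarAlgebra (A i)]

/-- The families `a i ∈ A i` with `a i = 1` for all but finitely many `i`, with pointwise
multiplication. They index the elementary tensors `⨂ a i`. -/
def finFam : Submonoid (∀ i, A i) where
  carrier := {a | {i | a i ≠ 1}.Finite}
  one_mem' := by simp
  mul_mem' {a b} ha hb := by
    refine (ha.union hb).subset fun i hi => ?_
    by_contra h
    simp only [Set.mem_union, Set.mem_ofPred_eq, not_or, not_not] at h
    exact hi (by simp [h.1, h.2])

/-- The monoid of families `a i ∈ A i` with `a i = 1` for all but finitely many `i`. -/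
abbrev FinFam : Type u := finFam A

variable {A}

theorem star_mem_finFam {a : ∀ i, A i} (ha : a ∈ finFam A) : star a ∈ finFam A :=
  Set.Finite.subset ha fun i hi h => hi (by simp [h])

instance : StarMul (FinFam A) where
  star a := ⟨star a.1, star_mem_finFam a.2⟩
  star_involutive a := Subtype.ext (star_star a.1)
  star_mul a b := Subtype.ext (star_mul a.1 b.1)

open Classical in
/-- Replace the `i`-th member of a family by `x`. -/
noncomputable def updateAt (a : FinFam A) (i : ι) (x : A i) : FinFam A :=
  ⟨Function.update a.1 i x, by
    refine (Set.Finite.insert i a.2).subset fun j hj => ?_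
    by_cases h : j = i
    · exact Or.inl h
    · right
      simpa [Function.update_of_ne h] using hj⟩

end InfTensor

/-! The *-algebra of formal linear combinations of the elements of a monoid with involution. -/

section MonoidAlgebraStar

variable {M : Type u} [Monoid M] [StarMul M]

/-- The involution of the monoid algebra: `(∑ c_m m)* = ∑ conj(c_m) m*`. -/
noncomputable def monoidStar : MonoidAlgebra ℂ M →+ MonoidAlgebra ℂ M :=
  AddMonoidHom.mk' (fun x : MonoidAlgebra ℂ M => x.coeff.sum fun m c => MonoidAlgebra.single (star m) (star c))
    fun x y => by
      rw [MonoidAlgebra.coeff_add]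
      exact Finsupp.sum_add_index' (h := fun m c => MonoidAlgebra.single (star m) (star c))
        (fun m => by simp) fun m c d => by simp

theorem monoidStar_single (m : M) (c : ℂ) :
    monoidStar (MonoidAlgebra.single m c) = MonoidAlgebra.single (star m) (star c) := by
  change (MonoidAlgebra.single m c).coeff.sum
    (fun m c => MonoidAlgebra.single (star m) (star c)) = _
  rw [MonoidAlgebra.coeff_single, Finsupp.sum_single_index (by simp)]

noncomputable instance : StarRing (MonoidAlgebra ℂ M) where
  star := monoidStar
  star_involutive x := by
    induction x using MonoidAlgebra.induction_linear with
    | zero => simp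
    | add x y hx hy => rw [map_add, map_add, hx, hy]
    | single m c => simp [monoidStar_single]
  star_mul x y := by
    change monoidStar (x * y) = monoidStar y * monoidStar x
    induction x using MonoidAlgebra.induction_linear with
    | zero => simp
    | add x x' hx hx' => rw [add_mul, map_add, map_add, mul_add, hx, hx']
    | single m c =>
      induction y using MonoidAlgebra.induction_linear with
      | zero => simp
      | add y y' hy hy' => rw [mul_add, map_add, map_add, add_mul, hy, hy']
      | single n d => simp [monoidStar_single, mul_comm]
  star_add := map_add monoidStar

instance : StarModule ℂ (MonoidAlgebra ℂ M) where
  star_smul c x := by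
    change monoidStar (c • x) = star c • monoidStar x
    induction x using MonoidAlgebra.induction_linear with
    | zero => simp
    | add x y hx hy => rw [smul_add, map_add, map_add, smul_add, hx, hy]
    | single m d => simp [monoidStar_single]

theorem star_single (m : M) (c : ℂ) :
    star (MonoidAlgebra.single m c) = MonoidAlgebra.single (star m) (star c) :=
  monoidStar_single m c

end MonoidAlgebraStar

section InfTensor

variable {ι : Type u} (A : ι → Type u) [∀ i, CStarAlgebra (A i)]

/-- The relations that make the elementary tensor `⨂ a i` linear in each factor. -/
inductive Multilinear : MonoidAlgebra ℂ (FinFam A) → MonoidAlgebra ℂ (FinFam A) → Prop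
  | add (a : FinFam A) (i : ι) (x y : A i) :
      Multilinear (MonoidAlgebra.of ℂ _ (updateAt a i (x + y)))
        (MonoidAlgebra.of ℂ _ (updateAt a i x) + MonoidAlgebra.of ℂ _ (updateAt a i y))
  | smul (a : FinFam A) (i : ι) (c : ℂ) (x : A i) :
      Multilinear (MonoidAlgebra.of ℂ _ (updateAt a i (c • x)))
        (c • MonoidAlgebra.of ℂ _ (updateAt a i x))

variable {A}

open Classical in
/-- A representation restricts to a *-homomorphism on each tensor factor. -/
noncomputable def restrictFactor {D : Type u} [CStarAlgebra D]
    (π : MonoidAlgebra ℂ (FinFam A) →⋆ₐ[ℂ] D) (hπ : ∀ a b, Multilinear A a b → π a = π b)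
    (i : ι) : A i →⋆ₐ[ℂ] D where
  toFun x := π (MonoidAlgebra.of ℂ _ (updateAt (1 : FinFam A) i x))
  map_one' := by
    rw [show updateAt (1 : FinFam A) i 1 = 1 from Subtype.ext (Function.update_eq_self i _),
      map_one, map_one]
  map_mul' x y := by
    rw [← map_mul, ← map_mul]
    congr 2
    refine Subtype.ext (funext fun j => ?_)
    by_cases h : j = i
    · subst h; simp [updateAt]
    · simp [updateAt, h]
  map_zero' := by
    have := hπ _ _ (Multilinear.smul 1 i 0 0)
    simpa using this
  map_add' x y := by rw [hπ _ _ (Multilinear.add 1 i x y), map_add]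
  commutes' c := by
    rw [Algebra.algebraMap_eq_smul_one, hπ _ _ (Multilinear.smul 1 i c 1), map_smul,
      show updateAt (1 : FinFam A) i 1 = 1 from Subtype.ext (Function.update_eq_self i _),
      map_one, map_one, Algebra.algebraMap_eq_smul_one]
  map_star' x := by
    rw [← map_star, MonoidAlgebra.of_apply, MonoidAlgebra.of_apply, star_single, star_one]
    congr 2
    refine Subtype.ext (funext fun j => ?_)
    change Function.update (1 : ∀ i, A i) i (star x) j = star (Function.update (1 : ∀ i, A i) i x j)
    by_cases h : j = i
    · subst h; simp
    · simp [h]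

theorem bddAbove_of (a : FinFam A) :
    BddAbove (repNorms (Multilinear A) (MonoidAlgebra.of ℂ _ a)) := by
  classical
  suffices h : ∀ s : Set ι, s.Finite → ∀ a : FinFam A, {i | a.1 i ≠ 1} ⊆ s →
      BddAbove (repNorms (Multilinear A) (MonoidAlgebra.of ℂ _ a)) from h _ a.2 a subset_rfl
  intro s hs
  induction s, hs using Set.Finite.induction_on with
  | empty =>
    intro a ha
    have : a = 1 := Subtype.ext (funext fun i => by_contra fun h => ha h)
    subst this
    refine ⟨‖(1 : ℂ)‖, ?_⟩
    rintro _ ⟨D, hD, π, hπ, rfl⟩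
    rw [map_one, map_one]
    simpa using NonUnitalStarAlgHom.norm_apply_le (StarAlgHom.ofId ℂ D) 1
  | @insert i s hi hs ih =>
    intro a ha
    obtain ⟨c, hc⟩ := ih (updateAt a i 1) fun j hj => by
      by_cases h : j = i
      · subst h; simp [updateAt] at hj
      · have : a.1 j ≠ 1 := by simpa [updateAt, h] using hj
        exact (ha this).resolve_left h
    refine ⟨‖a.1 i‖ * c, ?_⟩
    rintro _ ⟨D, hD, π, hπ, rfl⟩
    have hsplit : a = updateAt (1 : FinFam A) i (a.1 i) * updateAt a i 1 := by
      refine Subtype.ext (funext fun j => ?_)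
      by_cases h : j = i
      · subst h; simp [updateAt]
      · simp [updateAt, h]
    rw [hsplit, map_mul, map_mul]
    refine (norm_mul_le _ _).trans ?_
    gcongr
    · rw [← hsplit]
      exact NonUnitalStarAlgHom.norm_apply_le (restrictFactor π hπ i) (a.1 i)
    · exact hc ⟨D, hD, π, hπ, rfl⟩

instance : HasUniversalNorm (Multilinear A) where
  bddAbove x := by
    induction x using MonoidAlgebra.induction_linear with
    | zero => exact ⟨0, by rintro _ ⟨D, hD, π, -, rfl⟩; simp⟩
    | add x y hx hy =>
      obtain ⟨c, hc⟩ := hx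
      obtain ⟨d, hd⟩ := hy
      refine ⟨c + d, ?_⟩
      rintro _ ⟨D, hD, π, hπ, rfl⟩
      rw [map_add]
      exact (norm_add_le _ _).trans
        (add_le_add (hc ⟨D, hD, π, hπ, rfl⟩) (hd ⟨D, hD, π, hπ, rfl⟩))
    | single m c =>
      obtain ⟨d, hd⟩ := bddAbove_of m
      refine ⟨‖c‖ * d, ?_⟩
      rintro _ ⟨D, hD, π, hπ, rfl⟩
      have : MonoidAlgebra.single m c = c • MonoidAlgebra.of ℂ _ m := by simp
      rw [this, map_smul, norm_smul]
      gcongr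
      exact hd ⟨D, hD, π, hπ, rfl⟩

variable (A)

/-- The (maximal) infinite tensor product `⨂ A i` of a family of unital C*-algebras: the completion
of the linear combinations of the elementary tensors `⨂ a i` with `a i = 1` for all but finitely
many `i`, multilinear in the `a i`, in the supremum of the seminorms that come from
*-representations. It is the inductive limit of the finite maximal tensor products. -/
abbrev InfTensor : Type u := Universal (Multilinear A)

variable {A}

/-- The elementary tensor `⨂ a i`. -/
noncomputable def elemTensor (a : FinFam A) : InfTensor A :=
  Universal.of _ (MonoidAlgebra.of ℂ _ a)

/-- The element `x` of the `i`-th tensor factor, tensored with `1` elsewhere. -/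
noncomputable def incl (i : ι) (x : A i) : InfTensor A := elemTensor (updateAt 1 i x)

end InfTensor

/-! ### Embezzlement in the C*-algebraic model -/

/-- A state of a unital C*-algebra: a positive linear functional with value `1` at the unit.
(States are automatically continuous.) -/
def IsState {A : Type u} [CStarAlgebra A] (s : A →ₗ[ℂ] ℂ) : Prop :=
  (∀ a : A, 0 ≤ (s (star a * a)).re ∧ (s (star a * a)).im = 0) ∧ s 1 = 1

/-- The algebra `𝕄₂` of observables of one qubit. -/
abbrev M₂ : Type := CStarMatrix (Fin 2) (Fin 2) ℂ

open scoped ComplexOrder in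
noncomputable instance : CStarAlgebra M₂ := inferInstance

/-- The Hilbert space `ℂ² ⊗ ℂ²` of two qubits; `φ (i, j)` is the coefficient of `|ij⟩`. -/
abbrev TwoQubit : Type := EuclideanSpace ℂ (Fin 2 × Fin 2)

/-- `s₀(m) = ⟨0| m |0⟩`. -/
def s₀ (m : M₂) : ℂ := m 0 0

/-- The value `⟨φ| m ⊗ n |φ⟩` of the vector state `s_φ` of `𝕄₂ ⊗ 𝕄₂`. -/
noncomputable def vectorState (φ : TwoQubit) (m n : M₂) : ℂ :=
  ∑ i, ∑ j, ∑ k, ∑ l, star (φ (i, j)) * m i k * n j l * φ (k, l)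

/-- Embezzlement of the two-qubit state `φ` from the catalyst state `s` of `A ⊗ B` by means of the
*-automorphisms `α` of `A ⊗ 𝕄₂` and `β` of `B ⊗ 𝕄₂`:
`(s ⊗ s₀ ⊗ s₀)((α ⊗ β)(X)) = (s ⊗ s_φ)(X)` for all `X`. Both states are written on
`(A ⊗ 𝕄₂) ⊗ (B ⊗ 𝕄₂)`; they are determined by their values on the elementary tensors. -/
def Embezzles {A B : Type} [CStarAlgebra A] [CStarAlgebra B] (s : MaxTensor A B →ₗ[ℂ] ℂ)
    (α : MaxTensor A M₂ ≃⋆ₐ[ℂ] MaxTensor A M₂) (β : MaxTensor B M₂ ≃⋆ₐ[ℂ] MaxTensor B M₂)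
    (φ : TwoQubit) : Prop :=
  ∃ S T : MaxTensor (MaxTensor A M₂) (MaxTensor B M₂) →ₗ[ℂ] ℂ,
    IsState S ∧ (∀ a b m n, S (tmul (tmul a m) (tmul b n)) = s (tmul a b) * (s₀ m * s₀ n)) ∧
    IsState T ∧
      (∀ a b m n, T (tmul (tmul a m) (tmul b n)) = s (tmul a b) * vectorState φ m n) ∧
    ∀ X, S (tensorMap (α : MaxTensor A M₂ →⋆ₐ[ℂ] MaxTensor A M₂)
      (β : MaxTensor B M₂ →⋆ₐ[ℂ] MaxTensor B M₂) X) = T X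

/-! ### The algebras and the states of the protocol -/

/-- The CAR algebra `ℛ`, with one qubit at each site `i ∈ ℤ`. -/
abbrev CAR : Type := InfTensor fun _ : ℤ => M₂

/-- The index set `ℚ⁺` of the registers. -/
abbrev PosRat : Type := {q : ℚ // 0 < q}

/-- The algebra `⨂_{q ∈ ℚ⁺} ℛ` of each party. -/
abbrev Registers : Type := InfTensor fun _ : PosRat => CAR

/-- The observable `m` of the qubit at site `i` of register `q`. -/
noncomputable def site (q : PosRat) (i : ℤ) (m : M₂) : Registers :=
  incl (A := fun _ : PosRat => CAR) q (incl (A := fun _ : ℤ => M₂) i m)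

/-- `|φ_q⟩ = q₀ |00⟩ + q₁ |11⟩` with `q₀, q₁ > 0`, `q₀² + q₁² = 1` and `q₀² / q₁² = q`. -/
noncomputable def phi (q : PosRat) : TwoQubit :=
  WithLp.toLp 2 fun x =>
    if x = (0, 0) then ((Real.sqrt (q.1 / (1 + q.1)) : ℝ) : ℂ)
    else if x = (1, 1) then ((Real.sqrt (1 / (1 + q.1)) : ℝ) : ℂ)
    else 0

/-- `|00⟩`. -/
noncomputable def ket00 : TwoQubit := EuclideanSpace.single (0, 0) 1

/-- The state of the pair of qubits at site `i` of register `q`. -/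
noncomputable def siteVec (q : PosRat) (i : ℤ) : TwoQubit := if i ≤ 0 then ket00 else phi q

/-- `t` is the state `s_q` of `ℛ ⊗ ℛ`: the product over the sites of `|00⟩` (sites `i ≤ 0`) and
`|φ_q⟩` (sites `i ≥ 1`). -/
def IsRegisterState (q : PosRat) (t : MaxTensor CAR CAR →ₗ[ℂ] ℂ) : Prop :=
  IsState t ∧ ∀ a b : FinFam fun _ : ℤ => M₂,
    t (tmul (elemTensor a) (elemTensor b)) = ∏ᶠ i : ℤ, vectorState (siteVec q i) (a.1 i) (b.1 i)

/-- `s` is the product state `⨂_{q ∈ ℚ⁺} t q`. -/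
def IsProductState (t : PosRat → MaxTensor CAR CAR →ₗ[ℂ] ℂ)
    (s : MaxTensor Registers Registers →ₗ[ℂ] ℂ) : Prop :=
  IsState s ∧ ∀ a b : FinFam fun _ : PosRat => CAR,
    s (tmul (elemTensor a) (elemTensor b)) = ∏ᶠ q : PosRat, t q (tmul (a.1 q) (b.1 q))

/-! ### The local *-automorphisms of the protocol -/

/-- `σ` is the shift of the CAR algebra: the observable at site `i` goes to site `i + 1`. -/
def IsShift (σ : CAR ≃⋆ₐ[ℂ] CAR) : Prop :=
  ∀ (i : ℤ) (m : M₂), σ (incl (A := fun _ : ℤ => M₂) i m) =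
    incl (A := fun _ : ℤ => M₂) (i + 1) m

/-- `τ` acts as `σ` on register `q` and as the identity on the other registers. -/
def IsOnRegister (q : PosRat) (σ : CAR ≃⋆ₐ[ℂ] CAR) (τ : Registers ≃⋆ₐ[ℂ] Registers) : Prop :=
  ∀ (p : PosRat) (x : CAR), τ (incl (A := fun _ : PosRat => CAR) p x) =
    incl (A := fun _ : PosRat => CAR) p (if p = q then σ x else x)

/-- `w` swaps the qubit at site `0` of register `q` with the outside qubit. -/
def IsSwap (q : PosRat) (w : MaxTensor Registers M₂ ≃⋆ₐ[ℂ] MaxTensor Registers M₂) : Prop :=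
  (∀ m : M₂, w (tmul (site q 0 m) 1) = tmul 1 m) ∧
  (∀ m : M₂, w (tmul 1 m) = tmul (site q 0 m) 1) ∧
  ∀ (p : PosRat) (i : ℤ) (m : M₂), (p, i) ≠ (q, 0) → w (tmul (site p i m) 1) = tmul (site p i m) 1

/-- `ρ` is conjugation of the outside qubit by the unitary `U`: `a ⊗ m ↦ a ⊗ U* m U`. -/
def IsRotation (U : unitary M₂) (ρ : MaxTensor Registers M₂ ≃⋆ₐ[ℂ] MaxTensor Registers M₂) : Prop :=
  ∀ (a : Registers) (m : M₂), ρ (tmul a m) = tmul a (star (U : M₂) * m * (U : M₂))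

/-! ### The target states -/

/-- `(U ⊗ V) φ`. -/
noncomputable def localAct (U V : M₂) (φ : TwoQubit) : TwoQubit :=
  WithLp.toLp 2 fun x => ∑ k, ∑ l, U x.1 k * V x.2 l * φ (k, l)

/-- The entangled two-qubit states: unit vectors that are not product vectors. -/
def entangledStates : Set TwoQubit :=
  {φ | ‖φ‖ = 1 ∧ ¬∃ u v : Fin 2 → ℂ, ∀ i j, φ (i, j) = u i * v j}

/-- The two-qubit states `(U ⊗ V) |φ_q⟩` with `q ∈ ℚ⁺` and local unitaries `U`, `V`. -/
def targetStates : Set TwoQubit :=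
  {φ | ∃ (q : PosRat) (U V : unitary M₂), φ = localAct (U : M₂) (V : M₂) (phi q)}

end CStarEmbezzlement

namespace CStarEmbezzlement

universe u

/-! ### The Gelfand-Naimark-Segal construction for positive functionals on *-algebras -/

section GNS

open scoped ComplexOrder InnerProductSpace
open UniformSpace

variable {P : Type u} [Ring P] [StarRing P] [Algebra ℂ P]

/-! The protocol is Hilbert's hotel for qubits. In register `q` the pairs at sites `i ≤ 0` are in
`|00⟩` and the pairs at sites `i ≥ 1` in `|φ_q⟩`. Swapping the outside pair `|00⟩` with site `0`
changes no vector. In the Heisenberg picture the automorphism carries the outside observables to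
site `0` and then to site `1`, where they meet `φ_q`; the observables of site `0` go to the outside
pair, and every other site `i` goes to `i + 1`, on the same side of the boundary between `0` and
`1`. Hence the catalyst expectations are unchanged and the outside pair shows `φ_q`. This is
`fullVec_swapShiftPerm_none` together with `fullVec_swapShiftPerm_some`.

The analytic work is to make sense of the objects. A *-homomorphism out of a maximal tensor product
is a pair of commuting *-homomorphisms (`maxLift`), and out of an infinite one a family of commuting
*-homomorphisms (`infLift`); the shift, the swap and the rotations come from this. A functional on
the underlying *-algebra extends to a state if it is positive, respects the relations and makes left
multiplications bounded (`Universal.exists_isState`, by the GNS construction). For product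
functionals, positivity is Schur's theorem on entrywise products of positive semidefinite kernels,
and boundedness holds because unitaries span a C*-algebra.

On elementary tensors of single-site observables every state involved is one finite product over
qubit pairs, and the automorphism permutes the index set (`swapShift_fullTensor`), so embezzlement
becomes a reindexing of that product. Continuity extends it to all of the registers
(`embezzled_tmul`). A local rotation of the observables amounts to a rotation of the target vector
(`vectorState_localAct`).

Entanglement of the targets is read off the determinant of the coefficient matrix. Density follows
from the Schmidt decomposition (`exists_schmidt`) and the density of the rational Schmidt weights in
`[0, 1]`. -/

/-- Positivity of a linear functional on a *-algebra. -/
def IsPositive (f : P →ₗ[ℂ] ℂ) : Prop := ∀ x, 0 ≤ f (star x * x)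

/-- Left multiplication by `x` is bounded for the inner product defined by `f`. -/
def LeftBounded (f : P →ₗ[ℂ] ℂ) (x : P) : Prop :=
  ∃ C : ℝ, 0 ≤ C ∧ ∀ y, (f (star (x * y) * (x * y))).re ≤ C * (f (star y * y)).re

namespace LeftBounded

variable {f : P →ₗ[ℂ] ℂ}

/-- Isometries preserve the seminorm of `f`. All bounds below start here, since the elements of a
C*-algebra are linear combinations of unitaries. -/
theorem of_unitary {x : P} (hx : star x * x = 1) : LeftBounded f x :=
  ⟨1, zero_le_one, fun y => by
    rw [star_mul, mul_assoc, ← mul_assoc (star x), hx, one_mul, one_mul]⟩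

theorem zero : LeftBounded f 0 := ⟨0, le_rfl, fun y => by simp⟩

theorem smul [StarModule ℂ P] {x : P} (hx : LeftBounded f x) (c : ℂ) : LeftBounded f (c • x) := by
  obtain ⟨C, hC, h⟩ := hx
  refine ⟨‖c‖ ^ 2 * C, by positivity, fun y => ?_⟩
  have : f (star (c • x * y) * (c • x * y)) =
      ((‖c‖ ^ 2 : ℝ) : ℂ) * f (star (x * y) * (x * y)) := by
    rw [smul_mul_assoc, star_smul, smul_mul_assoc, mul_smul_comm, map_smul, map_smul,
      smul_eq_mul, smul_eq_mul, ← mul_assoc, Complex.star_def, Complex.conj_mul']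
    push_cast
    rfl
  rw [this, Complex.re_ofReal_mul, mul_assoc]
  exact mul_le_mul_of_nonneg_left (h y) (by positivity)

theorem mul {x y : P} (hx : LeftBounded f x) (hy : LeftBounded f y) : LeftBounded f (x * y) := by
  obtain ⟨C, hC, h⟩ := hx
  obtain ⟨D, hD, h'⟩ := hy
  refine ⟨C * D, by positivity, fun z => ?_⟩
  rw [mul_assoc x y z, mul_assoc C]
  exact (h _).trans (mul_le_mul_of_nonneg_left (h' z) hC)

theorem add (hf : IsPositive f) {x y : P} (hx : LeftBounded f x) (hy : LeftBounded f y) :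
    LeftBounded f (x + y) := by
  obtain ⟨C, hC, h⟩ := hx
  obtain ⟨D, hD, h'⟩ := hy
  refine ⟨2 * C + 2 * D, by positivity, fun z => ?_⟩
  -- Parallelogram inequality: positivity at the difference controls the cross terms at the cost of
  -- a factor 2.
  have h1 := (Complex.nonneg_iff.mp (hf (x * z - y * z))).1
  have h2 := h z
  have h3 := h' z
  simp only [star_sub, star_add, add_mul, mul_add, sub_mul, mul_sub, map_add, map_sub,
    Complex.add_re, Complex.sub_re] at h1 ⊢
  nlinarith

/-- Elements that `f` cannot tell apart inside products share their bounds. This is needed because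
the multilinear relations hold in the monoid algebra only modulo `f`. -/
theorem congr {x x' : P} (hx : LeftBounded f x)
    (h : ∀ y z, f (y * x * z) = f (y * x' * z))
    (h' : ∀ y z, f (y * star x * z) = f (y * star x' * z)) : LeftBounded f x' := by
  obtain ⟨C, hC, hb⟩ := hx
  refine ⟨C, hC, fun y => ?_⟩
  have : f (star (x' * y) * (x' * y)) = f (star (x * y) * (x * y)) := by
    rw [← mul_assoc, ← h, mul_assoc, star_mul, star_mul, ← h', mul_assoc]
  rw [this]
  exact hb y

end LeftBounded

variable [StarModule ℂ P]

/-- Polarization: reality of `f (x* x)` at `x = a + b` gives the imaginary parts, at `x = a + i b`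
the real parts. -/
theorem IsPositive.star_apply {f : P →ₗ[ℂ] ℂ} (hf : IsPositive f) (a b : P) :
    star (f (star a * b)) = f (star b * a) := by
  have h0 (x : P) : (f (star x * x)).im = 0 := (Complex.nonneg_iff.mp (hf x)).2.symm
  have h1 := h0 (a + b)
  have h2 := h0 (a + Complex.I • b)
  have ha := h0 a
  have hb := h0 b
  simp only [star_add, star_smul, add_mul, mul_add, map_add, smul_mul_assoc, mul_smul_comm,
    map_smul, smul_eq_mul, Complex.add_im, Complex.mul_im, Complex.mul_re, Complex.star_def,
    Complex.conj_I, Complex.neg_re, Complex.neg_im, Complex.I_re, Complex.I_im] at h1 h2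
  apply Complex.ext
  · simp only [Complex.star_def, Complex.conj_re]
    linarith
  · simp only [Complex.star_def, Complex.conj_im]
    linarith

/-- A copy of `P`, to carry the inner product `⟨a, b⟩ = f (a* b)`. -/
def PreGNS (f : P →ₗ[ℂ] ℂ) (_hf : IsPositive f) : Type u := P

namespace PreGNS

variable {f : P →ₗ[ℂ] ℂ} (hf : IsPositive f)

instance : AddCommGroup (PreGNS f hf) := inferInstanceAs (AddCommGroup P)
instance : Module ℂ (PreGNS f hf) := inferInstanceAs (Module ℂ P)

/-- The identity map from `P` to its copy. -/
def equiv : P ≃ₗ[ℂ] PreGNS f hf := LinearEquiv.refl ℂ _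

/-- The inner product `⟨a, b⟩ = f (a* b)`. -/
noncomputable abbrev core : PreInnerProductSpace.Core ℂ (PreGNS f hf) where
  inner a b := f (star ((equiv hf).symm a) * (equiv hf).symm b)
  conj_inner_symm a b := hf.star_apply _ _
  re_inner_nonneg a := (Complex.nonneg_iff.mp (hf _)).1
  add_left _ _ _ := by rw [map_add, star_add, add_mul, map_add]
  smul_left _ _ _ := by simp

noncomputable instance : SeminormedAddCommGroup (PreGNS f hf) :=
  InnerProductSpace.Core.toSeminormedAddCommGroup (c := core hf)
noncomputable instance : InnerProductSpace ℂ (PreGNS f hf) :=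
  InnerProductSpace.ofCore (core hf)

theorem inner_equiv (a b : P) : ⟪equiv hf a, equiv hf b⟫_ℂ = f (star a * b) := rfl

theorem norm_sq_equiv (a : P) : ‖equiv hf a‖ ^ 2 = (f (star a * a)).re := by
  rw [← inner_equiv hf, ← inner_self_eq_norm_sq (𝕜 := ℂ)]; rfl

end PreGNS

section Representation

variable {f : P →ₗ[ℂ] ℂ} (hf : IsPositive f) (hb : ∀ x, LeftBounded f x)

include hb in
theorem exists_norm_mul_le (x : P) :
    ∃ C : ℝ, ∀ y : P, ‖PreGNS.equiv hf (x * y)‖ ≤ C * ‖PreGNS.equiv hf y‖ := by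
  obtain ⟨C, hC, h⟩ := hb x
  refine ⟨√C, fun y => ?_⟩
  rw [← sq_le_sq₀ (by positivity) (by positivity), mul_pow, Real.sq_sqrt hC,
    PreGNS.norm_sq_equiv, PreGNS.norm_sq_equiv]
  exact h y

/-- Left multiplication by `x` as a bounded operator. -/
noncomputable def leftMul (x : P) : PreGNS f hf →L[ℂ] PreGNS f hf :=
  ((PreGNS.equiv hf).toLinearMap ∘ₗ LinearMap.mulLeft ℂ x ∘ₗ
    (PreGNS.equiv hf).symm.toLinearMap).mkContinuousOfExistsBound (exists_norm_mul_le hf hb x)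

theorem leftMul_equiv (x y : P) :
    leftMul hf hb x (PreGNS.equiv hf y) = PreGNS.equiv hf (x * y) := rfl

/-- The representation of `P` by left multiplication on the Hilbert space of `f`. -/
noncomputable def gnsRep :
    P →⋆ₐ[ℂ] (Completion (PreGNS f hf) →L[ℂ] Completion (PreGNS f hf)) where
  toFun a := (leftMul hf hb a).completion
  map_one' := by
    ext c
    induction c using Completion.induction_on with
    | hp => apply isClosed_eq <;> fun_prop
    | ih c =>
      obtain ⟨c, rfl⟩ := (PreGNS.equiv hf).surjective c
      simp [leftMul_equiv]
  map_zero' := by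
    ext c
    induction c using Completion.induction_on with
    | hp => apply isClosed_eq <;> fun_prop
    | ih c =>
      obtain ⟨c, rfl⟩ := (PreGNS.equiv hf).surjective c
      simp [leftMul_equiv, Completion.coe_zero]
  map_add' _ _ := by
    ext c
    induction c using Completion.induction_on with
    | hp => apply isClosed_eq <;> fun_prop
    | ih c =>
      obtain ⟨c, rfl⟩ := (PreGNS.equiv hf).surjective c
      simp [leftMul_equiv, add_mul, Completion.coe_add]
  map_mul' _ _ := by
    ext c
    induction c using Completion.induction_on with
    | hp => apply isClosed_eq <;> fun_prop
    | ih c =>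
      obtain ⟨c, rfl⟩ := (PreGNS.equiv hf).surjective c
      simp [leftMul_equiv, mul_assoc]
  commutes' k := by
    ext c
    induction c using Completion.induction_on with
    | hp => apply isClosed_eq <;> fun_prop
    | ih c =>
      obtain ⟨c, rfl⟩ := (PreGNS.equiv hf).surjective c
      simp [leftMul_equiv, Algebra.algebraMap_eq_smul_one]
  map_star' a := by
    refine (ContinuousLinearMap.eq_adjoint_iff (leftMul hf hb (star a)).completion
      (leftMul hf hb a).completion).mpr ?_
    intro x y
    induction x, y using Completion.induction_on₂ with
    | hp => apply isClosed_eq <;> fun_prop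
    | ih x y =>
      obtain ⟨x, rfl⟩ := (PreGNS.equiv hf).surjective x
      obtain ⟨y, rfl⟩ := (PreGNS.equiv hf).surjective y
      simp [leftMul_equiv, PreGNS.inner_equiv, mul_assoc]

theorem gnsRep_coe (x y : P) :
    gnsRep hf hb x (PreGNS.equiv hf y : Completion (PreGNS f hf)) =
      (PreGNS.equiv hf (x * y) : PreGNS f hf) :=
  ContinuousLinearMap.completion_apply_coe _ _

/-- A bounded operator is determined by its matrix coefficients between the dense vectors of `P`,
and these are values `f (v* a c)`. Thus relations respected by `f` pass to the representation. -/
theorem gnsRep_congr {a b : P} (hab : ∀ x y, f (x * a * y) = f (x * b * y)) :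
    gnsRep hf hb a = gnsRep hf hb b := by
  ext c
  induction c using Completion.induction_on with
  | hp => apply isClosed_eq <;> fun_prop
  | ih c =>
    obtain ⟨c, rfl⟩ := (PreGNS.equiv hf).surjective c
    refine ext_inner_left ℂ fun v => ?_
    induction v using Completion.induction_on with
    | hp => apply isClosed_eq <;> fun_prop
    | ih v =>
      obtain ⟨v, rfl⟩ := (PreGNS.equiv hf).surjective v
      rw [gnsRep_coe, gnsRep_coe, Completion.inner_coe, Completion.inner_coe,
        PreGNS.inner_equiv, PreGNS.inner_equiv, ← mul_assoc, ← mul_assoc, hab]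

end Representation

/-- Positivity is `⟪ξ, π(a* a) ξ⟫ = ‖π(a) ξ‖²`. -/
theorem operatorVectorState_isState {A : Type u} [CStarAlgebra A] {H : Type u}
    [NormedAddCommGroup H] [InnerProductSpace ℂ H] [CompleteSpace H]
    (π : A →⋆ₐ[ℂ] (H →L[ℂ] H)) {ξ : H} (hξ : ⟪ξ, ξ⟫_ℂ = 1) :
    IsState ((innerSL ℂ ξ).toLinearMap ∘ₗ (ContinuousLinearMap.apply ℂ H ξ).toLinearMap ∘ₗ
      (π : A →ₐ[ℂ] (H →L[ℂ] H)).toLinearMap) := by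
  refine ⟨fun a => ?_, by simpa using hξ⟩
  have h : ⟪ξ, π (star a * a) ξ⟫_ℂ = ⟪π a ξ, π a ξ⟫_ℂ := by
    rw [map_mul, map_star, mul_apply_eq_comp, ContinuousLinearMap.star_eq_adjoint,
      ContinuousLinearMap.adjoint_inner_right]
  change 0 ≤ (⟪ξ, π (star a * a) ξ⟫_ℂ).re ∧ (⟪ξ, π (star a * a) ξ⟫_ℂ).im = 0
  rw [h]
  exact ⟨inner_self_nonneg (𝕜 := ℂ), inner_self_im (𝕜 := ℂ) _⟩

/-- A positive functional on a *-algebra which respects the relations `r` and for which the left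
multiplications are bounded extends to a state of the universal C*-algebra. -/
theorem Universal.exists_isState (r : P → P → Prop) [HasUniversalNorm r] {f : P →ₗ[ℂ] ℂ}
    (hf : IsPositive f) (h1 : f 1 = 1) (hr : ∀ a b, r a b → ∀ x y, f (x * a * y) = f (x * b * y))
    (hb : ∀ x, LeftBounded f x) :
    ∃ F : Universal r →ₗ[ℂ] ℂ, IsState F ∧ Continuous F ∧ ∀ x, F (of r x) = f x := by
  have hrep : ∀ a b, r a b → gnsRep hf hb a = gnsRep hf hb b := fun a b h =>
    gnsRep_congr hf hb (hr a b h)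
  let π := lift (gnsRep hf hb) hrep
  let ξ : Completion (PreGNS f hf) := (PreGNS.equiv hf 1 : PreGNS f hf)
  refine ⟨_, operatorVectorState_isState π (ξ := ξ) ?_, ?_, fun x => ?_⟩
  · rw [Completion.inner_coe, PreGNS.inner_equiv, star_one, one_mul, h1]
  · have hπ : Continuous π := continuous_liftFun _
    change Continuous fun x => ⟪ξ, π x ξ⟫_ℂ
    fun_prop
  · change ⟪ξ, lift (gnsRep hf hb) hrep (of r x) ξ⟫_ℂ = f x
    rw [lift_of, gnsRep_coe, Completion.inner_coe, PreGNS.inner_equiv, star_one, one_mul, mul_one]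

end GNS

/-! ### Homomorphisms between tensor products -/

open scoped CStarAlgebra

section UniversalOf

variable {P : Type u} [Ring P] [StarRing P] [Algebra ℂ P] [StarModule ℂ P]

/-- Every representation entering the supremum identifies `a` and `b`, so `a - b` has seminorm zero
and dies in the Hausdorff completion. -/
theorem Universal.of_eq_of_rel {r : P → P → Prop} [HasUniversalNorm r] {a b : P} (h : r a b) :
    of r a = of r b := by
  rw [← sub_eq_zero, ← map_sub, ← norm_eq_zero]
  change ‖coe r (PreUniversal.ofAlg r (a - b))‖ = 0
  rw [norm_coe]
  refine le_antisymm (PreUniversal.norm_le le_rfl fun D hD π hπ => ?_)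
    (PreUniversal.norm_nonneg' _)
  rw [map_sub, map_sub, hπ a b h, sub_self, norm_zero]

end UniversalOf

section MaxTensor

open scoped TensorProduct

variable {A B D : Type u} [CStarAlgebra A] [CStarAlgebra B] [CStarAlgebra D]

theorem tmul_mul_tmul (a a' : A) (b b' : B) :
    tmul a b * tmul a' b' = tmul (a * a') (b * b') := by
  simp only [tmul, ← map_mul, Algebra.TensorProduct.tmul_mul_tmul]

variable (A B) in
theorem tmul_one_one : tmul (1 : A) (1 : B) = 1 :=
  map_one (Universal.of (NoRel (A ⊗[ℂ] B)))

variable (A B) in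
/-- The *-homomorphism `a ↦ a ⊗ 1`. -/
noncomputable def inlHom : A →⋆ₐ[ℂ] MaxTensor A B where
  toFun a := tmul a 1
  map_one' := tmul_one_one A B
  map_mul' a a' := by rw [tmul_mul_tmul, mul_one]
  map_zero' := by simp [tmul]
  map_add' a a' := by simp only [tmul, TensorProduct.add_tmul, map_add]
  commutes' c := (Universal.of (NoRel (A ⊗[ℂ] B))).commutes' c
  map_star' a := by
    simp only [tmul, ← map_star, TensorProduct.star_tmul, star_one]

variable (A B) in
/-- The *-homomorphism `b ↦ 1 ⊗ b`. -/
noncomputable def inrHom : B →⋆ₐ[ℂ] MaxTensor A B where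
  toFun b := tmul 1 b
  map_one' := tmul_one_one A B
  map_mul' a a' := by rw [tmul_mul_tmul, mul_one]
  map_zero' := by simp [tmul]
  map_add' a a' := by simp only [tmul, TensorProduct.tmul_add, map_add]
  commutes' c := by
    rw [Algebra.algebraMap_eq_smul_one, Algebra.algebraMap_eq_smul_one, ← tmul_one_one A B]
    simp only [tmul, TensorProduct.tmul_smul, map_smul]
  map_star' a := by
    simp only [tmul, ← map_star, TensorProduct.star_tmul, star_one]

theorem inlHom_apply (a : A) : inlHom A B a = tmul a 1 := rfl
theorem inrHom_apply (b : B) : inrHom A B b = tmul 1 b := rfl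

theorem tmul_eq_mul (a : A) (b : B) : tmul a b = inlHom A B a * inrHom A B b := by
  rw [inlHom_apply, inrHom_apply, tmul_mul_tmul, mul_one, one_mul]

theorem commute_inl_inr (a : A) (b : B) : Commute (tmul a (1 : B)) (tmul (1 : A) b) := by
  simp [Commute, SemiconjBy, tmul_mul_tmul]

theorem continuous_tmul_left (b : B) : Continuous fun a : A => tmul a b := by
  simp only [tmul_eq_mul]
  exact (map_continuous (inlHom A B)).mul continuous_const

theorem continuous_tmul_right (a : A) : Continuous fun b : B => tmul a b := by
  simp only [tmul_eq_mul]
  exact continuous_const.mul (map_continuous (inrHom A B))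

-- No clause for scalars is needed: a scalar is absorbed into one factor of an elementary tensor.
@[elab_as_elim]
theorem MaxTensor.induction {p : MaxTensor A B → Prop} (x : MaxTensor A B)
    (hc : IsClosed {x | p x}) (h0 : p 0) (hadd : ∀ x y, p x → p y → p (x + y))
    (htmul : ∀ a b, p (tmul a b)) : p x := by
  induction x using Universal.induction with
  | hc => exact hc
  | h x =>
    change p (Universal.of (NoRel (A ⊗[ℂ] B)) (PreUniversal.toAlg _ x))
    generalize PreUniversal.toAlg _ x = y
    induction y with
    | zero => rwa [map_zero]
    | tmul a b => exact htmul a b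
    | add x y hx hy => rw [map_add]; exact hadd _ _ hx hy

/-- Homomorphisms of C*-algebras are automatically continuous, so agreement on the two factors,
which generate a dense subalgebra, suffices. -/
theorem MaxTensor.hom_ext {φ ψ : MaxTensor A B →⋆ₐ[ℂ] D}
    (hl : ∀ a, φ (tmul a 1) = ψ (tmul a 1)) (hr : ∀ b, φ (tmul 1 b) = ψ (tmul 1 b)) : φ = ψ := by
  ext x
  induction x using MaxTensor.induction with
  | hc => exact isClosed_eq (map_continuous φ) (map_continuous ψ)
  | h0 => simp
  | hadd x y hx hy => rw [map_add, map_add, hx, hy]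
  | htmul a b =>
    rw [tmul_eq_mul, map_mul, map_mul, inlHom_apply, inrHom_apply, hl, hr]

/-- The universal property of the maximal tensor product: two commuting *-homomorphisms. -/
noncomputable def maxLift (f : A →⋆ₐ[ℂ] D) (g : B →⋆ₐ[ℂ] D) (h : ∀ a b, Commute (f a) (g b)) :
    MaxTensor A B →⋆ₐ[ℂ] D :=
  Universal.lift
    { Algebra.TensorProduct.lift (f : A →ₐ[ℂ] D) (g : B →ₐ[ℂ] D) h with
      map_star' := fun x => by
        change Algebra.TensorProduct.lift (f : A →ₐ[ℂ] D) (g : B →ₐ[ℂ] D) h (star x) =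
          star (Algebra.TensorProduct.lift (f : A →ₐ[ℂ] D) (g : B →ₐ[ℂ] D) h x)
        induction x with
        | zero => simp
        | tmul a b =>
          rw [TensorProduct.star_tmul, Algebra.TensorProduct.lift_tmul,
            Algebra.TensorProduct.lift_tmul, star_mul]
          change f (star a) * g (star b) = star (g b) * star (f a)
          rw [(h _ _).eq, map_star, map_star]
        | add x y hx hy => rw [star_add, map_add, map_add, star_add, hx, hy] }
    fun _ _ h => h.elim

theorem maxLift_tmul (f : A →⋆ₐ[ℂ] D) (g : B →⋆ₐ[ℂ] D) (h : ∀ a b, Commute (f a) (g b))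
    (a : A) (b : B) : maxLift f g h (tmul a b) = f a * g b :=
  (Universal.lift_of _ _ _).trans (Algebra.TensorProduct.lift_tmul _ _ h _ _)

end MaxTensor

/-! ### Generators of the infinite tensor product. -/

section InfTensor

variable {ι : Type u} {A : ι → Type u} [∀ i, CStarAlgebra (A i)]

theorem updateAt_same (a : FinFam A) (i : ι) (x : A i) : (updateAt a i x).1 i = x := by
  simp [updateAt]

theorem updateAt_ne (a : FinFam A) {i j : ι} (x : A i) (h : j ≠ i) :
    (updateAt a i x).1 j = a.1 j := by
  simp [updateAt, h]

theorem finFam_ext {a b : FinFam A} (h : ∀ i, a.1 i = b.1 i) : a = b := Subtype.ext (funext h)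

/-- Multiplication from both sides keeps the dependence on `x` inside the `i`-th factor; hence the
multilinear relations stay of the same shape in the two-sided ideal that they generate. -/
theorem mul_updateAt_mul (a b c : FinFam A) (i : ι) (x : A i) :
    a * updateAt b i x * c = updateAt (a * b * c) i (a.1 i * x * c.1 i) := by
  refine finFam_ext fun j => ?_
  by_cases h : j = i
  · subst h
    rw [updateAt_same, Submonoid.coe_mul, Submonoid.coe_mul, Pi.mul_apply, Pi.mul_apply,
      updateAt_same]
  · rw [updateAt_ne _ _ h, Submonoid.coe_mul, Submonoid.coe_mul, Pi.mul_apply, Pi.mul_apply,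
      updateAt_ne _ _ h]
    rfl

theorem updateAt_eq_mul (a : FinFam A) (i : ι) (x : A i) :
    updateAt a i x = updateAt a i 1 * updateAt 1 i x := by
  refine finFam_ext fun j => ?_
  by_cases h : j = i
  · subst h
    rw [updateAt_same, Submonoid.coe_mul, Pi.mul_apply, updateAt_same, updateAt_same, one_mul]
  · rw [updateAt_ne _ _ h, Submonoid.coe_mul, Pi.mul_apply, updateAt_ne _ _ h, updateAt_ne _ _ h]
    simp

theorem updateAt_self (a : FinFam A) (i : ι) : updateAt a i (a.1 i) = a := by
  refine finFam_ext fun j => ?_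
  by_cases h : j = i
  · subst h; rw [updateAt_same]
  · rw [updateAt_ne _ _ h]

theorem updateAt_one_one (i : ι) : updateAt (1 : FinFam A) i 1 = 1 := updateAt_self 1 i

theorem updateAt_one_mul (i : ι) (x y : A i) :
    updateAt (1 : FinFam A) i x * updateAt 1 i y = updateAt 1 i (x * y) := by
  refine finFam_ext fun j => ?_
  by_cases h : j = i
  · subst h
    rw [Submonoid.coe_mul, Pi.mul_apply, updateAt_same, updateAt_same, updateAt_same]
  · rw [Submonoid.coe_mul, Pi.mul_apply, updateAt_ne _ _ h, updateAt_ne _ _ h, updateAt_ne _ _ h]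
    exact mul_one _

theorem star_finFam_apply (a : FinFam A) (i : ι) : (star a).1 i = star (a.1 i) := rfl

theorem star_updateAt (a : FinFam A) (i : ι) (x : A i) :
    star (updateAt a i x) = updateAt (star a) i (star x) := by
  refine finFam_ext fun j => ?_
  by_cases h : j = i
  · subst h; rw [star_finFam_apply, updateAt_same, updateAt_same]
  · rw [star_finFam_apply, updateAt_ne _ _ h, updateAt_ne _ _ h, star_finFam_apply]

-- Single-factor families generate the monoid; the induction strips one index at a time from a
-- finite set that contains the support.
@[elab_as_elim]
theorem finFam_induction {p : FinFam A → Prop} (a : FinFam A) (one : p 1)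
    (mul : ∀ a b, p a → p b → p (a * b)) (single : ∀ i x, p (updateAt 1 i x)) : p a := by
  suffices h : ∀ s : Set ι, s.Finite → ∀ a : FinFam A, {i | a.1 i ≠ 1} ⊆ s → p a from
    h _ a.2 a subset_rfl
  intro s hs
  induction s, hs using Set.Finite.induction_on with
  | empty =>
    intro a ha
    rwa [show a = 1 from finFam_ext fun i => by_contra fun h => ha h]
  | @insert i s hi hs ih =>
    intro a ha
    rw [← updateAt_self a i, updateAt_eq_mul]
    refine mul _ _ (ih _ fun j hj => ?_) (single _ _)
    by_cases h : j = i
    · subst h; simp [updateAt] at hj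
    · have : a.1 j ≠ 1 := by simpa [updateAt, h] using hj
      exact (ha this).resolve_left h

theorem finFam_hom_ext {M : Type*} [Monoid M] {φ ψ : FinFam A →* M}
    (h : ∀ i x, φ (updateAt 1 i x) = ψ (updateAt 1 i x)) : φ = ψ := by
  ext a
  induction a using finFam_induction with
  | one => rw [map_one, map_one]
  | mul a b ha hb => rw [map_mul, map_mul, ha, hb]
  | single i x => exact h i x

variable (A) in
/-- The elementary tensors, as a homomorphism of monoids. -/
noncomputable def elemHom : FinFam A →* InfTensor A :=
  (Universal.of (Multilinear A) : MonoidAlgebra ℂ (FinFam A) →* InfTensor A).comp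
    (MonoidAlgebra.of ℂ _)

theorem elemTensor_mul (a b : FinFam A) : elemTensor (a * b) = elemTensor a * elemTensor b :=
  map_mul (elemHom A) a b

theorem elemTensor_one : elemTensor (1 : FinFam A) = 1 := map_one (elemHom A)

/-- The inclusion of the `i`-th factor. -/
noncomputable def inclHom (i : ι) : A i →⋆ₐ[ℂ] InfTensor A :=
  restrictFactor (Universal.of (Multilinear A)) (fun _ _ h => Universal.of_eq_of_rel h) i

theorem inclHom_apply (i : ι) (x : A i) : inclHom i x = incl i x := rfl

theorem commute_incl {i j : ι} (h : i ≠ j) (x : A i) (y : A j) :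
    Commute (incl i x) (incl j y) := by
  change elemTensor _ * elemTensor _ = elemTensor _ * elemTensor _
  rw [← elemTensor_mul, ← elemTensor_mul]
  congr 1
  refine finFam_ext fun k => ?_
  rw [Submonoid.coe_mul, Submonoid.coe_mul, Pi.mul_apply, Pi.mul_apply]
  by_cases hi : k = i
  · subst hi
    rw [updateAt_ne _ _ h]
    simp
  · rw [updateAt_ne _ _ hi]
    simp

-- The factors generate the infinite tensor product as a closed unital subalgebra.
@[elab_as_elim]
theorem InfTensor.induction {p : InfTensor A → Prop} (x : InfTensor A)
    (hc : IsClosed {x | p x}) (hone : p 1) (hadd : ∀ x y, p x → p y → p (x + y))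
    (hmul : ∀ x y, p x → p y → p (x * y)) (hsmul : ∀ (c : ℂ) x, p x → p (c • x))
    (hincl : ∀ i x, p (incl i x)) : p x := by
  induction x using Universal.induction with
  | hc => exact hc
  | h x =>
    change p (Universal.of (Multilinear A) (PreUniversal.toAlg _ x))
    generalize PreUniversal.toAlg _ x = y
    induction y using MonoidAlgebra.induction_linear with
    | zero => rw [map_zero]; simpa using hsmul 0 1 hone
    | add x y hx hy => rw [map_add]; exact hadd _ _ hx hy
    | single m c =>
      have : MonoidAlgebra.single m c = c • MonoidAlgebra.of ℂ _ m := by simp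
      rw [this, map_smul]
      refine hsmul _ _ ?_
      change p (elemTensor m)
      induction m using finFam_induction with
      | one => rwa [elemTensor_one]
      | mul a b ha hb => rw [elemTensor_mul]; exact hmul _ _ (ha (by simp)) (hb (by simp))
      | single i x => exact hincl i x

variable {D : Type u} [CStarAlgebra D]

theorem InfTensor.hom_ext {φ ψ : InfTensor A →⋆ₐ[ℂ] D}
    (h : ∀ i x, φ (incl i x) = ψ (incl i x)) : φ = ψ := by
  ext x
  induction x using InfTensor.induction with
  | hc => exact isClosed_eq (map_continuous φ) (map_continuous ψ)
  | hone => rw [map_one, map_one]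
  | hadd x y hx hy => rw [map_add, map_add, hx, hy]
  | hmul x y hx hy => rw [map_mul, map_mul, hx, hy]
  | hsmul c x hx => rw [map_smul, map_smul, hx]
  | hincl i x => exact h i x

/-- The elements whose image commutes with `d` form a closed subalgebra, so only the factors have to
be tested. -/
theorem InfTensor.commute_hom {φ : InfTensor A →⋆ₐ[ℂ] D} {d : D}
    (h : ∀ i x, Commute d (φ (incl i x))) (x : InfTensor A) : Commute d (φ x) := by
  induction x using InfTensor.induction with
  | hc =>
    exact isClosed_eq (continuous_const.mul (map_continuous φ))
      ((map_continuous φ).mul continuous_const)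
  | hone => rw [map_one]; exact Commute.one_right _
  | hadd x y hx hy => rw [map_add]; exact hx.add_right hy
  | hmul x y hx hy => rw [map_mul]; exact hx.mul_right hy
  | hsmul c x hx => rw [map_smul]; exact hx.smul_right c
  | hincl i x => exact h i x

end InfTensor

/-! ### The universal property of the infinite tensor product. -/

section InfLift

variable {ι : Type u} {A : ι → Type u} [∀ i, CStarAlgebra (A i)] {D : Type u} [CStarAlgebra D]
variable (f : ∀ i, A i →⋆ₐ[ℂ] D) (hf : ∀ i j, i ≠ j → ∀ x y, Commute (f i x) (f j y))

include hf in
theorem pairwise_commute (s : Finset ι) (a : FinFam A) :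
    (s : Set ι).Pairwise (Function.onFun Commute fun i => f i (a.1 i)) :=
  fun i _ j _ h => hf i j h _ _

/-- The product of the values of commuting *-homomorphisms over a finite set of indices. -/
noncomputable def prodOn (s : Finset ι) (a : FinFam A) : D :=
  s.noncommProd (fun i => f i (a.1 i)) (pairwise_commute f hf s a)

/-- Extra indices contribute the factor `1`; families with different supports can therefore be
compared over one index set. -/
theorem prodOn_eq_of_subset {s t : Finset ι} (h : s ⊆ t) (a : FinFam A)
    (ha : ∀ i ∈ t, i ∉ s → a.1 i = 1) : prodOn f hf t a = prodOn f hf s a := by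
  classical
  obtain ⟨u, hu, rfl⟩ : ∃ u, Disjoint s u ∧ t = s ∪ u :=
    ⟨t \ s, Finset.disjoint_sdiff, (Finset.union_sdiff_of_subset h).symm⟩
  rw [prodOn, Finset.noncommProd_union_of_disjoint hu,
    Finset.noncommProd_eq_pow_card u _ _ 1, one_pow, mul_one, prodOn]
  intro i hi
  rw [ha i (Finset.mem_union_right _ hi) fun h => Finset.disjoint_left.mp hu h hi, map_one]

theorem prodOn_mul (s : Finset ι) (a b : FinFam A) :
    prodOn f hf s (a * b) = prodOn f hf s a * prodOn f hf s b := by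
  rw [prodOn, prodOn, prodOn, ← Finset.noncommProd_mul_distrib]
  · exact Finset.noncommProd_congr rfl (fun i _ => map_mul _ _ _) _
  · exact fun i _ j _ h => hf _ _ h _ _

/-- The finite set of indices at which a family is not `1`. -/
noncomputable def supp (a : FinFam A) : Finset ι := a.2.toFinset

theorem mem_supp {a : FinFam A} {i : ι} : i ∈ supp a ↔ a.1 i ≠ 1 := Set.Finite.mem_toFinset _

/-- The homomorphism of monoids defined by commuting *-homomorphisms on the factors. -/
noncomputable def prodHom : FinFam A →* D where
  toFun a := prodOn f hf (supp a) a
  map_one' := by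
    rw [prodOn_eq_of_subset f hf (Finset.empty_subset _)]
    · rfl
    · intros; rfl
  map_mul' a b := by
    classical
    -- The support of `a * b` may be smaller than the union of the supports, so all three products
    -- are moved to a common finite set.
    have h (c : FinFam A) (hc : supp c ⊆ supp (a * b) ∪ (supp a ∪ supp b)) :
        prodOn f hf (supp c) c = prodOn f hf (supp (a * b) ∪ (supp a ∪ supp b)) c :=
      (prodOn_eq_of_subset f hf hc c fun i _ hi => by simpa [mem_supp] using hi).symm
    rw [h (a * b) Finset.subset_union_left,
      h a (Finset.subset_union_left.trans Finset.subset_union_right),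
      h b (Finset.subset_union_right.trans Finset.subset_union_right), prodOn_mul]

theorem prodHom_updateAt_one (i : ι) (x : A i) : prodHom f hf (updateAt 1 i x) = f i x := by
  change prodOn f hf (supp (updateAt 1 i x)) (updateAt 1 i x) = _
  have hs : supp (updateAt (1 : FinFam A) i x) ⊆ {i} := fun j hj => by
    by_contra h
    rw [Finset.mem_singleton] at h
    rw [mem_supp, updateAt_ne _ _ h] at hj
    exact hj rfl
  rw [← prodOn_eq_of_subset f hf hs _ fun j _ hj => by simpa [mem_supp] using hj, prodOn,
    Finset.noncommProd_singleton, updateAt_same]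

theorem prodHom_star (a : FinFam A) : prodHom f hf (star a) = star (prodHom f hf a) := by
  induction a using finFam_induction with
  | one => rw [star_one, map_one, star_one]
  | mul a b ha hb => rw [star_mul, map_mul, map_mul, star_mul, ha, hb]
  | single i x =>
    rw [star_updateAt, star_one, prodHom_updateAt_one, prodHom_updateAt_one, map_star]

/-- The *-homomorphism of the monoid algebra defined by commuting *-homomorphisms on the
factors. -/
noncomputable def algLift : MonoidAlgebra ℂ (FinFam A) →⋆ₐ[ℂ] D :=
  { MonoidAlgebra.lift ℂ D (FinFam A) (prodHom f hf) with
    map_star' := fun x => by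
      change MonoidAlgebra.lift ℂ D (FinFam A) (prodHom f hf) (star x) =
        star (MonoidAlgebra.lift ℂ D (FinFam A) (prodHom f hf) x)
      induction x using MonoidAlgebra.induction_linear with
      | zero => simp
      | add x y hx hy => rw [star_add, map_add, map_add, star_add, hx, hy]
      | single m c =>
        rw [star_single, MonoidAlgebra.lift_single, MonoidAlgebra.lift_single, star_smul,
          prodHom_star] }

theorem algLift_of (a : FinFam A) :
    algLift f hf (MonoidAlgebra.of ℂ _ a) = prodHom f hf a :=
  MonoidAlgebra.lift_of _ _

/-- Once the `i`-th factor is split off, the remaining product does not involve `x` and the value is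
linear in `f i x`. -/
theorem algLift_rel (a b : MonoidAlgebra ℂ (FinFam A)) (h : Multilinear A a b) :
    algLift f hf a = algLift f hf b := by
  have key (a : FinFam A) (i : ι) (x : A i) : algLift f hf (MonoidAlgebra.of ℂ _ (updateAt a i x))
      = prodHom f hf (updateAt a i 1) * f i x := by
    rw [algLift_of, updateAt_eq_mul, map_mul, prodHom_updateAt_one]
  cases h with
  | add a i x y => rw [map_add, key, key, key, map_add, mul_add]
  | smul a i c x => rw [map_smul, key, key, map_smul, mul_smul_comm]

/-- The universal property of the infinite tensor product: commuting *-homomorphisms on the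
factors. -/
noncomputable def infLift : InfTensor A →⋆ₐ[ℂ] D := Universal.lift (algLift f hf) (algLift_rel f hf)

theorem infLift_incl (i : ι) (x : A i) : infLift f hf (incl i x) = f i x :=
  (Universal.lift_of _ (algLift_rel f hf) _).trans
    ((algLift_of f hf _).trans (prodHom_updateAt_one f hf i x))

end InfLift

/-! ### Product states -/

section Kernels

open scoped ComplexOrder

theorem IsState.isPositive {A : Type u} [CStarAlgebra A] {s : A →ₗ[ℂ] ℂ} (hs : IsState s) :
    IsPositive s := fun a => Complex.nonneg_iff.mpr ⟨(hs.1 a).1, (hs.1 a).2.symm⟩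

/-- A Gram matrix: its quadratic form at coefficients `c` is `g (y* y)` with `y = ∑ c_m T_m`. -/
theorem posSemidef_kernel {Q : Type*} [Ring Q] [StarRing Q] [Algebra ℂ Q] [StarModule ℂ Q]
    {M : Type*} {g : Q →ₗ[ℂ] ℂ} (hg : IsPositive g) (T : M → Q) :
    (Matrix.of fun m n => g (star (T m) * T n)).PosSemidef := by
  refine ⟨Matrix.IsHermitian.ext fun m n => hg.star_apply _ _, fun x => ?_⟩
  have h := hg (x.sum fun m c => c • T m)
  rw [Finsupp.sum, star_sum, Finset.sum_mul, map_sum] at h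
  refine h.trans_eq (Finset.sum_congr rfl fun m _ => ?_)
  rw [Finset.mul_sum, map_sum]
  refine Finset.sum_congr rfl fun n _ => ?_
  rw [star_smul, smul_mul_assoc, mul_smul_comm, map_smul, map_smul, smul_eq_mul, smul_eq_mul,
    mul_comm (x n), ← mul_assoc]
  rfl

/-- Schur's product theorem, one factor at a time. -/
theorem posSemidef_kernel_prod {ι M : Type*} {Q : ι → Type*} [∀ i, Ring (Q i)]
    [∀ i, StarRing (Q i)] [∀ i, Algebra ℂ (Q i)] [∀ i, StarModule ℂ (Q i)]
    {g : ∀ i, Q i →ₗ[ℂ] ℂ} (hg : ∀ i, IsPositive (g i)) (T : ∀ i, M → Q i) (s : Finset ι) :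
    (Matrix.of fun m n => ∏ i ∈ s, g i (star (T i m) * T i n)).PosSemidef := by
  classical
  induction s using Finset.induction_on with
  | empty =>
    have := posSemidef_kernel (g := LinearMap.id) (Q := ℂ) (fun x => star_mul_self_nonneg x)
      (fun _ : M => 1)
    simpa using this
  | insert i s hi ih =>
    have h : (Matrix.of fun m n => ∏ i ∈ insert i s, g i (star (T i m) * T i n)) =
        (Matrix.of fun m n => g i (star (T i m) * T i n)).hadamard
          (Matrix.of fun m n => ∏ i ∈ s, g i (star (T i m) * T i n)) := by
      ext m n
      simp [Finset.prod_insert hi]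
    rw [h]
    exact (posSemidef_kernel (hg i) (T i)).hadamard ih

/-- The quadratic form at the all-ones vector of a finite submatrix. -/
theorem sum_sum_nonneg_of_posSemidef {M : Type*} {K : Matrix M M ℂ} (hK : K.PosSemidef)
    (s : Finset M) : 0 ≤ ∑ m ∈ s, ∑ n ∈ s, K m n := by
  classical
  have h := (hK.submatrix ((↑) : s → M)).dotProduct_mulVec_nonneg 1
  rw [← Finset.sum_coe_sort s]
  refine h.trans_eq (Finset.sum_congr rfl fun m _ => ?_)
  rw [← Finset.sum_coe_sort s]
  simp [Matrix.mulVec, dotProduct]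

end Kernels

/-! ### The product of two states. -/

section MaxProduct

open scoped TensorProduct ComplexOrder

variable {A B : Type u} [CStarAlgebra A] [CStarAlgebra B]

/-- The product of two states. -/
theorem MaxTensor.exists_product_state {f : A →ₗ[ℂ] ℂ} {g : B →ₗ[ℂ] ℂ} (hf : IsState f)
    (hg : IsState g) : ∃ F : MaxTensor A B →ₗ[ℂ] ℂ, IsState F ∧ Continuous F ∧
      ∀ a b, F (tmul a b) = f a * g b := by
  let L : A ⊗[ℂ] B →ₗ[ℂ] ℂ := LinearMap.mul' ℂ ℂ ∘ₗ TensorProduct.map f g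
  have hL (a b) : L (a ⊗ₜ b) = f a * g b := rfl
  -- For `x = ∑ a_m ⊗ b_m`, the value `L (x* x)` is the sum of the entries of the Hadamard product
  -- of the kernels `f (a_m* a_n)` and `g (b_m* b_n)`.
  have hpos : IsPositive L := fun x => by
    obtain ⟨S, rfl⟩ := TensorProduct.exists_finset x
    have h := sum_sum_nonneg_of_posSemidef ((posSemidef_kernel hf.isPositive Prod.fst).hadamard
      (posSemidef_kernel hg.isPositive Prod.snd)) S
    refine h.trans_eq ?_
    rw [star_sum, Finset.sum_mul, map_sum]
    refine Finset.sum_congr rfl fun m _ => ?_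
    rw [Finset.mul_sum, map_sum]
    refine Finset.sum_congr rfl fun n _ => ?_
    rw [TensorProduct.star_tmul, Algebra.TensorProduct.tmul_mul_tmul, hL]
    rfl
  -- Unitaries span `A`, and `u ⊗ 1` is an isometry for every unitary `u`.
  have hl (a : A) : LeftBounded L (a ⊗ₜ 1) := by
    have ha : a ∈ Submodule.span ℂ (unitary A : Set A) := by
      rw [CStarAlgebra.span_unitary]; trivial
    induction ha using Submodule.span_induction with
    | mem u hu =>
      refine .of_unitary ?_
      rw [TensorProduct.star_tmul, Algebra.TensorProduct.tmul_mul_tmul, (Unitary.mem_iff.mp hu).1,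
        star_one, one_mul]
      rfl
    | zero => simpa using LeftBounded.zero
    | add x y _ _ hx hy => rw [TensorProduct.add_tmul]; exact hx.add hpos hy
    | smul c x _ hx => rw [← TensorProduct.smul_tmul']; exact hx.smul c
  have hr (b : B) : LeftBounded L (1 ⊗ₜ b) := by
    have hb : b ∈ Submodule.span ℂ (unitary B : Set B) := by
      rw [CStarAlgebra.span_unitary]; trivial
    induction hb using Submodule.span_induction with
    | mem u hu =>
      refine .of_unitary ?_
      rw [TensorProduct.star_tmul, Algebra.TensorProduct.tmul_mul_tmul, (Unitary.mem_iff.mp hu).1,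
        star_one, one_mul]
      rfl
    | zero => simpa using LeftBounded.zero
    | add x y _ _ hx hy => rw [TensorProduct.tmul_add]; exact hx.add hpos hy
    | smul c x _ hx => rw [TensorProduct.tmul_smul]; exact hx.smul c
  obtain ⟨F, hF, hFc, hFL⟩ := Universal.exists_isState (NoRel (A ⊗[ℂ] B)) hpos
    (by rw [Algebra.TensorProduct.one_def, hL, hf.2, hg.2, one_mul]) (fun _ _ h => h.elim)
    fun x => by
      induction x with
      | zero => simpa using LeftBounded.zero
      | tmul a b =>
        have : a ⊗ₜ[ℂ] b = a ⊗ₜ 1 * 1 ⊗ₜ b := by simp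
        rw [this]
        exact (hl a).mul (hr b)
      | add x y hx hy => exact hx.add hpos hy
  exact ⟨F, hF, hFc, fun a b => (hFL _).trans (hL a b)⟩

end MaxProduct

/-! ### The product of an infinite family of states. -/

section InfProduct

open scoped ComplexOrder

variable {ι : Type u} {A : ι → Type u} [∀ i, CStarAlgebra (A i)] (f : ∀ i, A i →ₗ[ℂ] ℂ)

/-- The linear functional on the monoid algebra with the values `∏ f i (a i)`. -/
noncomputable def prodFunctional : MonoidAlgebra ℂ (FinFam A) →ₗ[ℂ] ℂ :=
  Finsupp.linearCombination ℂ (fun a : FinFam A => ∏ᶠ i, f i (a.1 i)) ∘ₗ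
    (MonoidAlgebra.coeffLinearEquiv ℂ).toLinearMap

theorem prodFunctional_single (a : FinFam A) (c : ℂ) :
    prodFunctional f (MonoidAlgebra.single a c) = c * ∏ᶠ i, f i (a.1 i) := by
  change Finsupp.linearCombination ℂ _ (Finsupp.single a c) = _
  rw [Finsupp.linearCombination_single, smul_eq_mul]

theorem prodFunctional_of (a : FinFam A) :
    prodFunctional f (MonoidAlgebra.of ℂ _ a) = ∏ᶠ i, f i (a.1 i) := by
  rw [MonoidAlgebra.of_apply, prodFunctional_single, one_mul]

/-- For `y = x` this displays the functional as the quadratic form of a product kernel at the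
coefficients of `x`. -/
theorem prodFunctional_star_mul (x y : MonoidAlgebra ℂ (FinFam A)) :
    prodFunctional f (star x * y) = x.coeff.sum fun m c => y.coeff.sum fun n d =>
      star c * (∏ᶠ i, f i (star (m.1 i) * n.1 i)) * d := by
  induction x using MonoidAlgebra.induction_linear with
  | zero => simp
  | add x x' hx hx' =>
    rw [star_add, add_mul, map_add, hx, hx', MonoidAlgebra.coeff_add, Finsupp.sum_add_index']
    · intro m; simp
    · intro m c d
      rw [← Finsupp.sum_add]
      simp only [star_add, add_mul]
  | single m c =>
    rw [MonoidAlgebra.coeff_single, Finsupp.sum_single_index (by simp)]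
    induction y using MonoidAlgebra.induction_linear with
    | zero => simp
    | add y y' hy hy' =>
      rw [mul_add, map_add, hy, hy', MonoidAlgebra.coeff_add, Finsupp.sum_add_index']
      · intro m; simp
      · intro m c d; rw [mul_add]
    | single n d =>
      rw [MonoidAlgebra.coeff_single, Finsupp.sum_single_index (by simp), star_single,
        MonoidAlgebra.single_mul_single, prodFunctional_single]
      change star c * d * (∏ᶠ i, f i (star (m.1 i) * n.1 i)) = _
      ring

variable {f} (hf : ∀ i, IsState (f i))

include hf in
theorem finprod_eq_prod (a : FinFam A) {t : Finset ι} (ht : supp a ⊆ t) :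
    ∏ᶠ i, f i (a.1 i) = ∏ i ∈ t, f i (a.1 i) := by
  refine finprod_eq_prod_of_mulSupport_subset _ fun i hi => ht (mem_supp.mpr fun h => hi ?_)
  change f i (a.1 i) = 1
  rw [h, (hf i).2]

include hf in
theorem finprod_updateAt (a : FinFam A) (i : ι) (x : A i) :
    ∏ᶠ j, f j ((updateAt a i x).1 j) = f i x * ∏ᶠ j, f j ((updateAt a i 1).1 j) := by
  classical
  have hs (y : A i) : supp (updateAt a i y) ⊆ insert i (supp a) := fun j hj => by
    by_cases h : j = i
    · subst h; exact Finset.mem_insert_self _ _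
    · rw [mem_supp, updateAt_ne _ _ h] at hj
      exact Finset.mem_insert_of_mem (mem_supp.mpr hj)
  rw [finprod_eq_prod hf _ (hs x), finprod_eq_prod hf _ (hs 1),
    ← Finset.mul_prod_erase _ _ (Finset.mem_insert_self i _),
    ← Finset.mul_prod_erase _ (fun j => f j ((updateAt a i 1).1 j)) (Finset.mem_insert_self i _),
    updateAt_same, updateAt_same, (hf i).2, one_mul]
  congr 1
  refine Finset.prod_congr rfl fun j hj => ?_
  rw [updateAt_ne _ _ (Finset.ne_of_mem_erase hj), updateAt_ne _ _ (Finset.ne_of_mem_erase hj)]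

include hf in
theorem prodFunctional_isPositive : IsPositive (prodFunctional f) := fun x => by
  classical
  rw [prodFunctional_star_mul]
  -- Outside `t` all families occurring in `x` are `1`, so each infinite product becomes a product
  -- over the same finite set and the Schur kernel applies.
  let t : Finset ι := x.coeff.support.biUnion supp
  have h := (posSemidef_kernel_prod (fun i => (hf i).isPositive)
    (fun i (m : FinFam A) => m.1 i) t).2 x.coeff
  refine h.trans_eq (Finset.sum_congr rfl fun m hm => Finset.sum_congr rfl fun n hn => ?_)
  have hs : supp (star m * n) ⊆ t := fun i hi => by
    rw [mem_supp] at hi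
    by_contra ht
    have hm' : m.1 i = 1 := by
      by_contra h
      exact ht (Finset.mem_biUnion.mpr ⟨m, hm, mem_supp.mpr h⟩)
    have hn' : n.1 i = 1 := by
      by_contra h
      exact ht (Finset.mem_biUnion.mpr ⟨n, hn, mem_supp.mpr h⟩)
    refine hi ?_
    change star (m.1 i) * n.1 i = 1
    rw [hm', hn', star_one, one_mul]
  have := finprod_eq_prod hf (star m * n) hs
  change ∏ᶠ i, f i (star (m.1 i) * n.1 i) = ∏ i ∈ t, f i (star (m.1 i) * n.1 i) at this
  beta_reduce
  rw [this]
  rfl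

-- Multiplying by `x` and `y` on the two sides is what the GNS representation requires; by
-- bilinearity they may be monomials, and then only the `i`-th factor of the product changes.
include hf in
theorem prodFunctional_rel (a b : MonoidAlgebra ℂ (FinFam A)) (hab : Multilinear A a b)
    (x y : MonoidAlgebra ℂ (FinFam A)) :
    prodFunctional f (x * a * y) = prodFunctional f (x * b * y) := by
  induction x using MonoidAlgebra.induction_linear with
  | zero => simp
  | add x x' hx hx' => simp only [add_mul, map_add, hx, hx']
  | single m c =>
    induction y using MonoidAlgebra.induction_linear with
    | zero => simp
    | add y y' hy hy' => simp only [mul_add, map_add, hy, hy']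
    | single n d =>
      have key (a : FinFam A) (i : ι) (z : A i) :
          prodFunctional f (MonoidAlgebra.single m c * MonoidAlgebra.of ℂ _ (updateAt a i z) *
            MonoidAlgebra.single n d) = c * d * (f i (m.1 i * z * n.1 i) *
              ∏ᶠ j, f j ((updateAt (m * a * n) i 1).1 j)) := by
        rw [MonoidAlgebra.of_apply, MonoidAlgebra.single_mul_single,
          MonoidAlgebra.single_mul_single, prodFunctional_single, mul_updateAt_mul,
          finprod_updateAt hf, mul_one]
      cases hab with
      | add a i z w =>
        rw [mul_add, add_mul, map_add, key, key, key, mul_add, add_mul, map_add]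
        ring
      | smul a i k z =>
        rw [mul_smul_comm, smul_mul_assoc, map_smul, key, key, mul_smul_comm, smul_mul_assoc,
          map_smul, smul_eq_mul, smul_eq_mul]
        ring

include hf in
theorem prodFunctional_leftBounded (x : MonoidAlgebra ℂ (FinFam A)) :
    LeftBounded (prodFunctional f) x := by
  have hpos := prodFunctional_isPositive hf
  have hstar (i : ι) (z : A i) : star (MonoidAlgebra.of ℂ (FinFam A) (updateAt 1 i z)) =
      MonoidAlgebra.of ℂ _ (updateAt 1 i (star z)) := by
    rw [MonoidAlgebra.of_apply, MonoidAlgebra.of_apply, star_single, star_updateAt, star_one,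
      star_one]
  have hone : LeftBounded (prodFunctional f) 1 := .of_unitary (by rw [star_one, one_mul])
  induction x using MonoidAlgebra.induction_linear with
  | zero => exact .zero
  | add x y hx hy => exact hx.add hpos hy
  | single m c =>
    have : MonoidAlgebra.single m c = c • MonoidAlgebra.of ℂ _ m := by simp
    rw [this]
    refine LeftBounded.smul ?_ c
    induction m using finFam_induction with
    | one => rwa [map_one]
    | mul a b ha hb => rw [map_mul]; exact (ha (by simp)).mul (hb (by simp))
    | single i z =>
      have hz : z ∈ Submodule.span ℂ (unitary (A i) : Set (A i)) := by
        rw [CStarAlgebra.span_unitary]; trivial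
      clear this
      -- Linear operations inside the factor match those of the monoid algebra only modulo the
      -- relations, whence `LeftBounded.congr` in all cases but the first.
      induction hz using Submodule.span_induction with
      | mem u hu =>
        refine .of_unitary ?_
        rw [hstar, ← map_mul]
        rw [updateAt_one_mul, (Unitary.mem_iff.mp hu).1, updateAt_one_one, map_one]
      | zero =>
        have h := Multilinear.smul (1 : FinFam A) i 0 0
        rw [smul_zero, zero_smul] at h
        refine LeftBounded.zero.congr (fun y z => (prodFunctional_rel hf _ _ h y z).symm)
          fun y z => ?_
        rw [star_zero, hstar, star_zero]
        exact (prodFunctional_rel hf _ _ h y z).symm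
      | add x y _ _ hx hy =>
        refine (hx.add hpos hy).congr (fun v w =>
          (prodFunctional_rel hf _ _ (Multilinear.add 1 i x y) v w).symm) fun v w => ?_
        rw [star_add, hstar, hstar, hstar, star_add]
        exact (prodFunctional_rel hf _ _ (Multilinear.add 1 i _ _) v w).symm
      | smul k x _ hx =>
        refine (hx.smul k).congr (fun v w =>
          (prodFunctional_rel hf _ _ (Multilinear.smul 1 i k x) v w).symm) fun v w => ?_
        rw [star_smul, hstar, hstar, star_smul]
        exact (prodFunctional_rel hf _ _ (Multilinear.smul 1 i _ _) v w).symm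

include hf in
/-- The product of a family of states. -/
theorem InfTensor.exists_product_state : ∃ F : InfTensor A →ₗ[ℂ] ℂ, IsState F ∧ Continuous F ∧
    ∀ a : FinFam A, F (elemTensor a) = ∏ᶠ i, f i (a.1 i) := by
  have h1 : prodFunctional f 1 = 1 := by
    rw [← map_one (MonoidAlgebra.of ℂ (FinFam A)), prodFunctional_of]
    exact finprod_eq_one_of_forall_eq_one fun i => (hf i).2
  obtain ⟨F, hF, hFc, hFL⟩ := Universal.exists_isState (Multilinear A)
    (prodFunctional_isPositive hf) h1 (prodFunctional_rel hf) (prodFunctional_leftBounded hf)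
  exact ⟨F, hF, hFc, fun a => (hFL _).trans (prodFunctional_of f a)⟩

end InfProduct

theorem IsState.comp {A B : Type u} [CStarAlgebra A] [CStarAlgebra B] {s : B →ₗ[ℂ] ℂ}
    (hs : IsState s) (φ : A →⋆ₐ[ℂ] B) : IsState (s ∘ₗ (φ : A →ₐ[ℂ] B).toLinearMap) := by
  refine ⟨fun a => ?_, ?_⟩
  · change 0 ≤ (s (φ (star a * a))).re ∧ (s (φ (star a * a))).im = 0
    rw [map_mul, map_star]
    exact hs.1 _
  · change s (φ 1) = 1
    rw [map_one, hs.2]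

/-! ### Factorwise homomorphisms and product states of two parties. -/

section FactorMaps

variable {ι : Type u} {A B C : ι → Type u} [∀ i, CStarAlgebra (A i)] [∀ i, CStarAlgebra (B i)]
  [∀ i, CStarAlgebra (C i)]

/-- Apply a *-homomorphism in each factor of a family. -/
def finFamMap (h : ∀ i, A i →⋆ₐ[ℂ] C i) : FinFam A →* FinFam C where
  toFun a := ⟨fun i => h i (a.1 i), a.2.subset fun i hi h1 => hi (by simp [h1])⟩
  map_one' := finFam_ext fun i => map_one (h i)
  map_mul' a b := finFam_ext fun i => map_mul (h i) _ _

theorem finFamMap_updateAt_one (h : ∀ i, A i →⋆ₐ[ℂ] C i) (i : ι) (x : A i) :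
    finFamMap h (updateAt 1 i x) = updateAt 1 i (h i x) := by
  refine finFam_ext fun j => ?_
  change h j ((updateAt 1 i x).1 j) = _
  by_cases hj : j = i
  · subst hj; rw [updateAt_same, updateAt_same]
  · rw [updateAt_ne _ _ hj, updateAt_ne _ _ hj]
    exact map_one (h j)

/-- The infinite tensor product of *-homomorphisms. -/
noncomputable def infMap (h : ∀ i, A i →⋆ₐ[ℂ] C i) : InfTensor A →⋆ₐ[ℂ] InfTensor C :=
  infLift (fun i => (inclHom i).comp (h i)) fun _ _ hij _ _ => commute_incl hij _ _

theorem infMap_incl (h : ∀ i, A i →⋆ₐ[ℂ] C i) (i : ι) (x : A i) :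
    infMap h (incl i x) = incl i (h i x) := infLift_incl _ _ i x

theorem infMap_elemTensor (h : ∀ i, A i →⋆ₐ[ℂ] C i) (a : FinFam A) :
    infMap h (elemTensor a) = elemTensor (finFamMap h a) := by
  have : (infMap h : InfTensor A →* InfTensor C).comp (elemHom A) =
      (elemHom C).comp (finFamMap h) := finFam_hom_ext fun i x => by
    change infMap h (incl i x) = elemTensor (finFamMap h (updateAt 1 i x))
    rw [infMap_incl, finFamMap_updateAt_one, incl]
  exact DFunLike.congr_fun this a

/-- The product state on the tensor product of two infinite tensor products, when the `i`-th
factors are represented by commuting *-homomorphisms in an algebra with the state `g i`. -/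
theorem exists_pair_product_state (l : ∀ i, A i →⋆ₐ[ℂ] C i) (r : ∀ i, B i →⋆ₐ[ℂ] C i)
    (hlr : ∀ i x y, Commute (l i x) (r i y)) {g : ∀ i, C i →ₗ[ℂ] ℂ} (hg : ∀ i, IsState (g i)) :
    ∃ F : MaxTensor (InfTensor A) (InfTensor B) →ₗ[ℂ] ℂ, IsState F ∧ Continuous F ∧
      ∀ a b, F (tmul (elemTensor a) (elemTensor b)) = ∏ᶠ i, g i (l i (a.1 i) * r i (b.1 i)) := by
  -- The product state is built on `InfTensor C`, where the two parties' factors sit together index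
  -- by index, and is pulled back along the commuting maps `infMap l` and `infMap r`. This performs
  -- the reordering of the tensor factors.
  obtain ⟨F, hF, hFc, hFg⟩ := InfTensor.exists_product_state hg
  have hcomm (x : InfTensor A) (y : InfTensor B) : Commute (infMap l x) (infMap r y) := by
    refine InfTensor.commute_hom (fun j b => ?_) y
    refine (InfTensor.commute_hom (fun i a => ?_) x).symm
    rw [infMap_incl, infMap_incl]
    by_cases h : j = i
    · subst h
      exact (Commute.map (hlr j a b).symm (inclHom (A := C) j) :)
    · exact commute_incl h _ _
  refine ⟨_, hF.comp (maxLift (infMap l) (infMap r) hcomm),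
    hFc.comp (map_continuous (maxLift (infMap l) (infMap r) hcomm)), fun a b => ?_⟩
  change F (maxLift (infMap l) (infMap r) hcomm _) = _
  rw [maxLift_tmul, infMap_elemTensor, infMap_elemTensor, ← elemTensor_mul, hFg]
  rfl

end FactorMaps

/-! ### Vector states of two qubits -/

section TwoQubits

/-- The observables of two qubits. -/
abbrev M₄ : Type := CStarMatrix (Fin 2 × Fin 2) (Fin 2 × Fin 2) ℂ

open scoped ComplexOrder in
noncomputable instance : CStarAlgebra M₄ := inferInstance

open scoped ComplexOrder

/-- The Kronecker product of the observables of two qubits. -/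
noncomputable def kron (m n : M₂) : M₄ :=
  CStarMatrix.ofMatrix (Matrix.kronecker (m : Matrix (Fin 2) (Fin 2) ℂ) n)

theorem kron_apply (m n : M₂) (x y : Fin 2 × Fin 2) : kron m n x y = m x.1 y.1 * n x.2 y.2 := rfl

theorem kron_mul_kron (m n m' n' : M₂) : kron m n * kron m' n' = kron (m * m') (n * n') :=
  (Matrix.mul_kronecker_mul (α := ℂ) (l := Fin 2) (m := Fin 2) (n := Fin 2) (l' := Fin 2)
    (m' := Fin 2) (n' := Fin 2) m m' n n').symm

theorem kron_one_one : kron 1 1 = 1 := Matrix.one_kronecker_one (α := ℂ) (m := Fin 2) (n := Fin 2)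

theorem star_kron (m n : M₂) : star (kron m n) = kron (star m) (star n) :=
  CStarMatrix.ext fun x y => by
    simp only [CStarMatrix.star_apply, kron_apply, star_mul']

/-- `m ↦ m ⊗ 1`. -/
noncomputable def leftQubit : M₂ →⋆ₐ[ℂ] M₄ where
  toFun m := kron m 1
  map_one' := kron_one_one
  map_mul' m n := by rw [kron_mul_kron, one_mul]
  map_zero' := CStarMatrix.ext fun x y => by simp [kron_apply]
  map_add' m n := CStarMatrix.ext fun x y => by simp [kron_apply, add_mul]
  commutes' c := by
    rw [Algebra.algebraMap_eq_smul_one, Algebra.algebraMap_eq_smul_one, ← kron_one_one]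
    exact CStarMatrix.ext fun x y => by simp [kron_apply, mul_assoc]
  map_star' m := by rw [star_kron, star_one]

/-- `n ↦ 1 ⊗ n`. -/
noncomputable def rightQubit : M₂ →⋆ₐ[ℂ] M₄ where
  toFun n := kron 1 n
  map_one' := kron_one_one
  map_mul' m n := by rw [kron_mul_kron, one_mul]
  map_zero' := CStarMatrix.ext fun x y => by simp [kron_apply]
  map_add' m n := CStarMatrix.ext fun x y => by simp [kron_apply, mul_add]
  commutes' c := by
    rw [Algebra.algebraMap_eq_smul_one, Algebra.algebraMap_eq_smul_one, ← kron_one_one]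
    exact CStarMatrix.ext fun x y => by simp [kron_apply, mul_left_comm]
  map_star' m := by rw [star_kron, star_one]

theorem leftQubit_mul_rightQubit (m n : M₂) : leftQubit m * rightQubit n = kron m n := by
  change kron m 1 * kron 1 n = _
  rw [kron_mul_kron, mul_one, one_mul]

theorem commute_leftQubit_rightQubit (m n : M₂) : Commute (leftQubit m) (rightQubit n) := by
  change kron m 1 * kron 1 n = kron 1 n * kron m 1
  rw [kron_mul_kron, kron_mul_kron, mul_one, one_mul, mul_one, one_mul]

/-- The vector functional `M ↦ ⟨φ| M |φ⟩`. -/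
noncomputable def vectorFunctional (φ : TwoQubit) : M₄ →ₗ[ℂ] ℂ where
  toFun M := ∑ x, ∑ y, star (φ x) * M x y * φ y
  map_add' M N := by
    simp only [CStarMatrix.add_apply, mul_add, add_mul, Finset.sum_add_distrib]
  map_smul' c M := by
    simp only [CStarMatrix.smul_apply, smul_eq_mul, RingHom.id_apply, Finset.mul_sum]
    refine Finset.sum_congr rfl fun x _ => Finset.sum_congr rfl fun y _ => ?_
    ring

theorem vectorFunctional_apply (φ : TwoQubit) (M : M₄) :
    vectorFunctional φ M = ∑ x, ∑ y, star (φ x) * M x y * φ y := rfl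

theorem vectorFunctional_isState {φ : TwoQubit} (hφ : ‖φ‖ = 1) :
    IsState (vectorFunctional φ) := by
  refine ⟨fun M => ?_, ?_⟩
  -- `⟨φ| M* M |φ⟩ = ‖M φ‖²`, written in coordinates.
  · have h : vectorFunctional φ (star M * M) =
        ∑ z, star (∑ x, M z x * φ x) * (∑ y, M z y * φ y) := by
      simp only [vectorFunctional_apply, CStarMatrix.mul_apply, CStarMatrix.star_apply, star_sum,
        star_mul', Finset.mul_sum, Finset.sum_mul]
      rw [Finset.sum_congr rfl fun x _ => Finset.sum_comm, Finset.sum_comm]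
      refine Finset.sum_congr rfl fun z _ => ?_
      rw [Finset.sum_comm]
      refine Finset.sum_congr rfl fun x _ => Finset.sum_congr rfl fun y _ => ?_
      ring
    have h' : 0 ≤ vectorFunctional φ (star M * M) := by
      rw [h]
      exact Finset.sum_nonneg fun z _ => star_mul_self_nonneg _
    exact ⟨(Complex.nonneg_iff.mp h').1, (Complex.nonneg_iff.mp h').2.symm⟩
  · have h := EuclideanSpace.norm_sq_eq φ
    rw [hφ] at h
    rw [vectorFunctional_apply]
    have (x : Fin 2 × Fin 2) : ∑ y, star (φ x) * (1 : M₄) x y * φ y = ((‖φ x‖ ^ 2 : ℝ) : ℂ) := by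
      rw [Finset.sum_eq_single x]
      · rw [CStarMatrix.one_apply_eq, mul_one, Complex.star_def, Complex.conj_mul']; push_cast; rfl
      · intro y _ hy; rw [CStarMatrix.one_apply_ne hy.symm]; ring
      · simp
    simp only [this]
    rw [← Complex.ofReal_sum, ← h]
    simp

theorem vectorFunctional_mul (φ : TwoQubit) (m n : M₂) :
    vectorFunctional φ (leftQubit m * rightQubit n) = vectorState φ m n := by
  simp only [vectorFunctional_apply, leftQubit_mul_rightQubit, kron_apply, vectorState,
    Fintype.sum_prod_type]
  refine Finset.sum_congr rfl fun x _ => Finset.sum_congr rfl fun y _ =>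
    Finset.sum_congr rfl fun z _ => Finset.sum_congr rfl fun w _ => ?_
  ring

theorem vectorState_one_one {φ : TwoQubit} (hφ : ‖φ‖ = 1) : vectorState φ 1 1 = 1 := by
  rw [← vectorFunctional_mul, map_one, map_one, one_mul, (vectorFunctional_isState hφ).2]

end TwoQubits

/-! ### The catalyst state -/

theorem norm_ket00 : ‖ket00‖ = 1 := by simp [ket00]

theorem phi_apply (q : PosRat) (x : Fin 2 × Fin 2) : phi q x =
    if x = (0, 0) then ((Real.sqrt (q.1 / (1 + q.1)) : ℝ) : ℂ)
    else if x = (1, 1) then ((Real.sqrt (1 / (1 + q.1)) : ℝ) : ℂ) else 0 := rfl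

theorem norm_phi (q : PosRat) : ‖phi q‖ = 1 := by
  have hq : (0 : ℝ) < q.1 := by exact_mod_cast q.2
  have h : ‖phi q‖ ^ 2 = 1 := by
    rw [EuclideanSpace.norm_sq_eq, Fintype.sum_prod_type]
    simp only [phi_apply, Fin.sum_univ_two]
    simp only [Prod.mk.injEq, Fin.isValue, and_self, if_true, one_ne_zero, zero_ne_one, and_false,
      false_and, if_false, norm_zero, Complex.norm_real, Real.norm_eq_abs, sq_abs]
    rw [Real.sq_sqrt (by positivity), Real.sq_sqrt (by positivity)]
    field_simp
    ring
  exact (pow_eq_one_iff_of_nonneg (norm_nonneg _) two_ne_zero).mp h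

theorem norm_siteVec (q : PosRat) (i : ℤ) : ‖siteVec q i‖ = 1 := by
  unfold siteVec
  split_ifs
  · exact norm_ket00
  · exact norm_phi q

theorem exists_isRegisterState (q : PosRat) : ∃ t, IsRegisterState q t := by
  obtain ⟨F, hF, -, hFg⟩ := exists_pair_product_state (ι := ℤ) (C := fun _ => M₄)
    (fun _ => leftQubit) (fun _ => rightQubit) (fun _ => commute_leftQubit_rightQubit)
    (g := fun i => vectorFunctional (siteVec q i)) (fun i => vectorFunctional_isState (norm_siteVec q i))
  exact ⟨F, hF, fun a b => (hFg a b).trans (finprod_congr fun i => vectorFunctional_mul _ _ _)⟩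

/-- Continuity is recorded because functionals are later compared on a dense subspace only, and
`IsState` does not contain it. -/
theorem exists_isProductState {t : PosRat → MaxTensor CAR CAR →ₗ[ℂ] ℂ} (ht : ∀ q, IsState (t q)) :
    ∃ s, IsProductState t s ∧ Continuous s := by
  obtain ⟨F, hF, hFc, hFg⟩ := exists_pair_product_state (ι := PosRat) (fun _ => inlHom CAR CAR)
    (fun _ => inrHom CAR CAR) (fun _ => commute_inl_inr) ht
  exact ⟨F, ⟨hF, fun a b => (hFg a b).trans (finprod_congr fun i => by rw [tmul_eq_mul])⟩, hFc⟩

/-! ### Elementary tensors of the observables of all sites -/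

/-- The finitely supported families of observables of the sites of all registers. -/
abbrev SiteFam : Type := FinFam fun _ : PosRat × ℤ => M₂

/-- The observables in register `q`. -/
def siteRow (q : PosRat) : SiteFam →* FinFam fun _ : ℤ => M₂ where
  toFun g := ⟨fun i => g.1 (q, i),
    g.2.preimage (f := fun i => (q, i)) fun _ _ _ _ h => (Prod.ext_iff.mp h).2⟩
  map_one' := rfl
  map_mul' _ _ := rfl

theorem siteRow_apply (q : PosRat) (g : SiteFam) (i : ℤ) : (siteRow q g).1 i = g.1 (q, i) := rfl

/-- The elementary tensors of all registers. -/
noncomputable def registerFam : SiteFam →* FinFam fun _ : PosRat => CAR where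
  toFun g := ⟨fun q => elemTensor (siteRow q g), (g.2.image Prod.fst).subset fun q hq => by
    by_contra h
    refine hq ?_
    have : siteRow q g = 1 := finFam_ext fun i => by_contra fun hi => h ⟨(q, i), hi, rfl⟩
    change elemTensor _ = 1
    rw [this, elemTensor_one]⟩
  map_one' := finFam_ext fun q => elemTensor_one
  map_mul' a b := finFam_ext fun q => elemTensor_mul (siteRow q a) (siteRow q b)

/-- The elementary tensor of a family of observables of the sites of all registers. -/
noncomputable def siteTensor : SiteFam →* Registers := (elemHom _).comp registerFam

theorem siteTensor_updateAt_one (j : PosRat × ℤ) (m : M₂) :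
    siteTensor (updateAt (1 : SiteFam) j m) = site j.1 j.2 m := by
  obtain ⟨q, i⟩ := j
  change elemTensor (registerFam _) = elemTensor _
  congr 1
  refine finFam_ext fun p => ?_
  change elemTensor (siteRow p _) = _
  by_cases h : p = q
  · subst h
    rw [updateAt_same]
    change _ = elemTensor _
    congr 1
    refine finFam_ext fun k => ?_
    rw [siteRow_apply]
    by_cases hk : k = i
    · subst hk; rw [updateAt_same, updateAt_same]
    · rw [updateAt_ne _ _ hk, updateAt_ne _ _ (by simpa using hk)]; rfl
  · rw [updateAt_ne _ _ h]
    have : siteRow p (updateAt 1 (q, i) m) = 1 := finFam_ext fun k => by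
      rw [siteRow_apply, updateAt_ne _ _ (by simp [h])]
      rfl
    rw [this]
    exact elemTensor_one

theorem hasFiniteMulSupport_siteVec (g h : SiteFam) : Function.HasFiniteMulSupport
    fun j : PosRat × ℤ => vectorState (siteVec j.1 j.2) (g.1 j) (h.1 j) := by
  refine (g.2.union h.2).subset fun j hj => ?_
  by_contra hn
  simp only [Set.mem_union, Set.mem_ofPred_eq, not_or, not_not] at hn
  refine hj ?_
  change vectorState _ _ _ = 1
  rw [hn.1, hn.2, vectorState_one_one (norm_siteVec _ _)]

/-- The iterated product over registers and sites becomes a single product over all qubit pairs; in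
this form a permutation of the qubits acts by reindexing. -/
theorem productState_siteTensor {t : PosRat → MaxTensor CAR CAR →ₗ[ℂ] ℂ}
    {s : MaxTensor Registers Registers →ₗ[ℂ] ℂ} (ht : ∀ q, IsRegisterState q (t q))
    (hs : IsProductState t s) (g h : SiteFam) : s (tmul (siteTensor g) (siteTensor h)) =
      ∏ᶠ j : PosRat × ℤ, vectorState (siteVec j.1 j.2) (g.1 j) (h.1 j) := by
  rw [finprod_curry _ (hasFiniteMulSupport_siteVec g h)]
  refine (hs.2 (registerFam g) (registerFam h)).trans (finprod_congr fun q => ?_)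
  exact (ht q).2 (siteRow q g) (siteRow q h)

@[elab_as_elim]
theorem Registers.induction {p : Registers → Prop} (x : Registers)
    (hc : IsClosed {x | p x}) (hone : p 1) (hadd : ∀ x y, p x → p y → p (x + y))
    (hmul : ∀ x y, p x → p y → p (x * y)) (hsmul : ∀ (c : ℂ) x, p x → p (c • x))
    (hsite : ∀ q i m, p (site q i m)) : p x := by
  induction x using InfTensor.induction with
  | hc => exact hc
  | hone => exact hone
  | hadd x y hx hy => exact hadd x y hx hy
  | hmul x y hx hy => exact hmul x y hx hy
  | hsmul c x hx => exact hsmul c x hx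
  | hincl q x =>
    rw [← inclHom_apply]
    induction x using InfTensor.induction with
    | hc => exact hc.preimage (map_continuous (inclHom (A := fun _ : PosRat => CAR) q))
    | hone => rwa [map_one]
    | hadd x y hx hy => rw [map_add]; exact hadd _ _ hx hy
    | hmul x y hx hy => rw [map_mul]; exact hmul _ _ hx hy
    | hsmul c x hx => rw [map_smul]; exact hsmul _ _ hx
    | hincl i m => exact hsite q i m

theorem Registers.hom_ext {D : Type} [CStarAlgebra D] {φ ψ : Registers →⋆ₐ[ℂ] D}
    (h : ∀ q i m, φ (site q i m) = ψ (site q i m)) : φ = ψ := by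
  ext x
  induction x using Registers.induction with
  | hc => exact isClosed_eq (map_continuous φ) (map_continuous ψ)
  | hone => rw [map_one, map_one]
  | hadd x y hx hy => rw [map_add, map_add, hx, hy]
  | hmul x y hx hy => rw [map_mul, map_mul, hx, hy]
  | hsmul c x hx => rw [map_smul, map_smul, hx]
  | hsite q i m => exact h q i m

/-- The site tensors form a monoid, so the algebra that they generate is just their linear span; it
contains all single-site observables and is therefore dense. -/
theorem Registers.linear_ext {φ ψ : Registers →ₗ[ℂ] ℂ} (hφ : Continuous φ) (hψ : Continuous ψ)
    (h : ∀ g, φ (siteTensor g) = ψ (siteTensor g)) : φ = ψ := by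
  let V : Subalgebra ℂ Registers := Algebra.adjoin ℂ (MonoidHom.mrange siteTensor)
  have hV (x : Registers) : x ∈ V.topologicalClosure := by
    induction x using Registers.induction with
    | hc => exact V.isClosed_topologicalClosure
    | hone => exact one_mem _
    | hadd x y hx hy => exact add_mem hx hy
    | hmul x y hx hy => exact mul_mem hx hy
    | hsmul c x hx => exact Subalgebra.smul_mem _ hx c
    | hsite q i m =>
      refine V.le_topologicalClosure (Algebra.subset_adjoin ⟨updateAt 1 (q, i) m, ?_⟩)
      exact siteTensor_updateAt_one (q, i) m
  have hle : (V : Set Registers) ⊆ {x | φ x = ψ x} := fun x hx => by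
    have hx' : x ∈ Subalgebra.toSubmodule V := hx
    rw [Algebra.adjoin_eq_span, Submonoid.closure_eq] at hx'
    refine Submodule.span_induction (p := fun x _ => φ x = ψ x) ?_ ?_ ?_ ?_ hx'
    · rintro _ ⟨g, rfl⟩; exact h g
    · rw [map_zero, map_zero]
    · intro x y _ _ hx hy; rw [map_add, map_add, hx, hy]
    · intro c x _ hx; rw [map_smul, map_smul, hx]
  ext x
  exact closure_minimal hle (isClosed_eq hφ hψ) (hV x)

/-! ### The automorphisms -/

theorem commute_incl_add (k i j : ℤ) (h : i ≠ j) (x y : M₂) :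
    Commute (inclHom (A := fun _ : ℤ => M₂) (i + k) x) (inclHom (A := fun _ : ℤ => M₂) (j + k) y) :=
  commute_incl (A := fun _ : ℤ => M₂) (fun h' => h (add_right_cancel h')) x y

/-- The endomorphism of the CAR algebra which moves all sites by `k`. -/
noncomputable def moveHom (k : ℤ) : CAR →⋆ₐ[ℂ] CAR :=
  infLift (fun i => inclHom (A := fun _ : ℤ => M₂) (i + k)) (commute_incl_add k)

theorem moveHom_incl (k i : ℤ) (m : M₂) : moveHom k (incl (A := fun _ : ℤ => M₂) i m) =
    incl (A := fun _ : ℤ => M₂) (i + k) m :=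
  infLift_incl (A := fun _ : ℤ => M₂) (fun i => inclHom (A := fun _ : ℤ => M₂) (i + k))
    (commute_incl_add k) i m

theorem exists_isShift : ∃ σ, IsShift σ := by
  refine ⟨StarAlgEquiv.ofStarAlgHom (moveHom 1) (moveHom (-1)) ?_ ?_, moveHom_incl 1⟩
  · refine InfTensor.hom_ext fun i m => ?_
    change moveHom (-1) (moveHom 1 _) = incl (A := fun _ : ℤ => M₂) i m
    rw [moveHom_incl, moveHom_incl, add_neg_cancel_right]
  · refine InfTensor.hom_ext fun i m => ?_
    change moveHom 1 (moveHom (-1) _) = incl (A := fun _ : ℤ => M₂) i m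
    rw [moveHom_incl, moveHom_incl, neg_add_cancel_right]

open Classical in
/-- Apply an endomorphism of the CAR algebra in register `q`. -/
noncomputable def onRegister (q : PosRat) (σ : CAR →⋆ₐ[ℂ] CAR) : Registers →⋆ₐ[ℂ] Registers :=
  infMap fun p => if p = q then σ else StarAlgHom.id ℂ CAR

theorem onRegister_incl (q : PosRat) (σ : CAR →⋆ₐ[ℂ] CAR) (p : PosRat) (x : CAR) :
    onRegister q σ (incl (A := fun _ : PosRat => CAR) p x) =
      incl (A := fun _ : PosRat => CAR) p (if p = q then σ x else x) := by
  rw [onRegister, infMap_incl]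
  split_ifs <;> rfl

theorem exists_isOnRegister (q : PosRat) (σ : CAR ≃⋆ₐ[ℂ] CAR) : ∃ τ, IsOnRegister q σ τ := by
  refine ⟨StarAlgEquiv.ofStarAlgHom (onRegister q (σ : CAR →⋆ₐ[ℂ] CAR))
    (onRegister q (σ.symm : CAR →⋆ₐ[ℂ] CAR)) ?_ ?_, onRegister_incl q (σ : CAR →⋆ₐ[ℂ] CAR)⟩
  · refine InfTensor.hom_ext fun i m => ?_
    change onRegister q (σ.symm : CAR →⋆ₐ[ℂ] CAR) (onRegister q (σ : CAR →⋆ₐ[ℂ] CAR) _) =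
      incl (A := fun _ : PosRat => CAR) i m
    rw [onRegister_incl, onRegister_incl]
    split_ifs
    · congr 1; exact σ.symm_apply_apply m
    · rfl
  · refine InfTensor.hom_ext fun i m => ?_
    change onRegister q (σ : CAR →⋆ₐ[ℂ] CAR) (onRegister q (σ.symm : CAR →⋆ₐ[ℂ] CAR) _) =
      incl (A := fun _ : PosRat => CAR) i m
    rw [onRegister_incl, onRegister_incl]
    split_ifs
    · congr 1; exact σ.apply_symm_apply m
    · rfl

theorem exists_tensorEquiv {A B : Type u} [CStarAlgebra A] [CStarAlgebra B] (f : A ≃⋆ₐ[ℂ] A)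
    (g : B ≃⋆ₐ[ℂ] B) : ∃ e : MaxTensor A B ≃⋆ₐ[ℂ] MaxTensor A B,
      ∀ x, e x = tensorMap (f : A →⋆ₐ[ℂ] A) (g : B →⋆ₐ[ℂ] B) x := by
  refine ⟨StarAlgEquiv.ofStarAlgHom (tensorMap (f : A →⋆ₐ[ℂ] A) (g : B →⋆ₐ[ℂ] B))
    (tensorMap (f.symm : A →⋆ₐ[ℂ] A) (g.symm : B →⋆ₐ[ℂ] B)) ?_ ?_, fun x => rfl⟩
  · refine MaxTensor.hom_ext (fun a => ?_) fun b => ?_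
    all_goals
      change tensorMap _ _ (tensorMap _ _ _) = tmul _ _
      rw [tensorMap_tmul, tensorMap_tmul]
      simp
  · refine MaxTensor.hom_ext (fun a => ?_) fun b => ?_
    all_goals
      change tensorMap _ _ (tensorMap _ _ _) = tmul _ _
      rw [tensorMap_tmul, tensorMap_tmul]
      simp

theorem exists_isRotation (U : unitary M₂) : ∃ ρ, IsRotation U ρ := by
  -- Conjugation by `star U`, because the rotation is `m ↦ U* m U` and not `U m U*`.
  obtain ⟨e, he⟩ := exists_tensorEquiv (StarAlgEquiv.refl ℂ Registers)
    (Unitary.conjStarAlgAut ℂ M₂ (star U))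
  refine ⟨e, fun a m => ?_⟩
  rw [he, tensorMap_tmul]
  change tmul a (Unitary.conjStarAlgAut ℂ M₂ (star U) m) = _
  rw [Unitary.conjStarAlgAut_star_apply]

/-- The inclusion of the observables of a site. -/
noncomputable def siteHom (j : PosRat × ℤ) : M₂ →⋆ₐ[ℂ] Registers :=
  (inclHom (A := fun _ : PosRat => CAR) j.1).comp (inclHom (A := fun _ : ℤ => M₂) j.2)

theorem commute_siteHom {j k : PosRat × ℤ} (h : j ≠ k) (m n : M₂) :
    Commute (siteHom j m) (siteHom k n) := by
  obtain ⟨p, i⟩ := j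
  obtain ⟨q, l⟩ := k
  by_cases hp : p = q
  · subst hp
    have hi : i ≠ l := fun hi => h (by rw [hi])
    exact Commute.map (commute_incl (A := fun _ : ℤ => M₂) hi m n)
      (inclHom (A := fun _ : PosRat => CAR) p)
  · exact commute_incl (A := fun _ : PosRat => CAR) hp _ _

/-! ### Homomorphisms of the registers defined site by site. -/

section RegistersLift

variable {D : Type} [CStarAlgebra D] (w : PosRat × ℤ → (M₂ →⋆ₐ[ℂ] D))
  (hw : ∀ j k, j ≠ k → ∀ x y, Commute (w j x) (w k y))

include hw in
theorem commute_row (p : PosRat) (i k : ℤ) (h : i ≠ k) (x y : M₂) :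
    Commute (w (p, i) x) (w (p, k) y) := hw _ _ (by simpa using h) _ _

/-- The *-homomorphism of register `p` defined by commuting *-homomorphisms on the sites. -/
noncomputable def rowLift (p : PosRat) : CAR →⋆ₐ[ℂ] D :=
  infLift (A := fun _ : ℤ => M₂) (fun i => w (p, i)) (commute_row w hw p)

theorem rowLift_incl (p : PosRat) (i : ℤ) (m : M₂) :
    rowLift w hw p (incl (A := fun _ : ℤ => M₂) i m) = w (p, i) m :=
  infLift_incl (A := fun _ : ℤ => M₂) (fun i => w (p, i)) (commute_row w hw p) i m

theorem commute_rowLift (p q : PosRat) (h : p ≠ q) (x y : CAR) :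
    Commute (rowLift w hw p x) (rowLift w hw q y) := by
  refine InfTensor.commute_hom (fun j b => ?_) y
  refine (InfTensor.commute_hom (fun i a => ?_) x).symm
  rw [rowLift_incl, rowLift_incl]
  exact hw _ _ (fun h' => h (Prod.ext_iff.mp h').1.symm) _ _

/-- The *-homomorphism of all registers defined by commuting *-homomorphisms on the sites. -/
noncomputable def registersLift : Registers →⋆ₐ[ℂ] D :=
  infLift (A := fun _ : PosRat => CAR) (rowLift w hw) (commute_rowLift w hw)

theorem registersLift_site (p : PosRat) (i : ℤ) (m : M₂) :
    registersLift w hw (site p i m) = w (p, i) m :=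
  (infLift_incl (A := fun _ : PosRat => CAR) (rowLift w hw) (commute_rowLift w hw) p _).trans
    (rowLift_incl w hw p i m)

end RegistersLift

open Classical in
/-- The images of the sites under the swap of the qubit at site `j` with the outside qubit. -/
noncomputable def swapSite (j k : PosRat × ℤ) : M₂ →⋆ₐ[ℂ] MaxTensor Registers M₂ :=
  if k = j then inrHom Registers M₂ else (inlHom Registers M₂).comp (siteHom k)

theorem swapSite_self (j : PosRat × ℤ) (m : M₂) : swapSite j j m = tmul 1 m := by
  rw [swapSite, if_pos rfl, inrHom_apply]

theorem swapSite_of_ne {j k : PosRat × ℤ} (h : k ≠ j) (m : M₂) :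
    swapSite j k m = tmul (site k.1 k.2 m) 1 := by
  rw [swapSite, if_neg h]
  rfl

theorem commute_swapSite (j k l : PosRat × ℤ) (h : k ≠ l) (x y : M₂) :
    Commute (swapSite j k x) (swapSite j l y) := by
  by_cases hk : k = j
  · subst hk
    rw [swapSite_self, swapSite_of_ne h.symm]
    exact (commute_inl_inr _ _).symm
  · rw [swapSite_of_ne hk]
    by_cases hl : l = j
    · subst hl
      rw [swapSite_self]
      exact commute_inl_inr _ _
    · rw [swapSite_of_ne hl]
      exact Commute.map (commute_siteHom h x y) (inlHom Registers M₂)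

/-- After the swap the registers occupy all sites except `j` and the outside qubit, so site `j` is
free to receive the outside observables. -/
theorem commute_registersLift_swapSite (j : PosRat × ℤ) (x : Registers) (m : M₂) :
    Commute (registersLift (swapSite j) (commute_swapSite j) x)
      ((inlHom Registers M₂).comp (siteHom j) m) := by
  induction x using Registers.induction with
  | hc =>
    have := map_continuous (registersLift (swapSite j) (commute_swapSite j))
    exact isClosed_eq (this.mul continuous_const) (continuous_const.mul this)
  | hone => rw [map_one]; exact Commute.one_left _
  | hadd x y hx hy => rw [map_add]; exact hx.add_left hy
  | hmul x y hx hy => rw [map_mul]; exact hx.mul_left hy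
  | hsmul c x hx => rw [map_smul]; exact hx.smul_left c
  | hsite q i n =>
    rw [registersLift_site]
    by_cases h : (q, i) = j
    · subst h
      rw [swapSite_self]
      exact (commute_inl_inr _ _).symm
    · rw [swapSite_of_ne h]
      exact Commute.map (commute_siteHom h n m) (inlHom Registers M₂)

/-- The swap of the qubit at site `j` with the outside qubit, as an endomorphism. -/
noncomputable def swapHom (j : PosRat × ℤ) : MaxTensor Registers M₂ →⋆ₐ[ℂ] MaxTensor Registers M₂ :=
  maxLift (registersLift (swapSite j) (commute_swapSite j))
    ((inlHom Registers M₂).comp (siteHom j)) (commute_registersLift_swapSite j)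

theorem swapHom_site (j : PosRat × ℤ) (p : PosRat) (i : ℤ) (m : M₂) :
    swapHom j (tmul (site p i m) 1) = swapSite j (p, i) m := by
  rw [swapHom, maxLift_tmul, registersLift_site, map_one, mul_one]

theorem swapHom_outside (j : PosRat × ℤ) (m : M₂) :
    swapHom j (tmul 1 m) = tmul (site j.1 j.2 m) 1 := by
  rw [swapHom, maxLift_tmul, map_one, one_mul]
  rfl

/-- The swap is an involution, hence an automorphism that is its own inverse. -/
theorem swapHom_comp_self (j : PosRat × ℤ) :
    (swapHom j).comp (swapHom j) = StarAlgHom.id ℂ _ := by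
  refine MaxTensor.hom_ext (fun a => ?_) fun b => ?_
  · have : ((swapHom j).comp (swapHom j)).comp (inlHom Registers M₂) = inlHom Registers M₂ := by
      refine Registers.hom_ext fun p i m => ?_
      change swapHom j (swapHom j (tmul _ 1)) = tmul _ 1
      rw [swapHom_site]
      by_cases h : (p, i) = j
      · subst h
        rw [swapSite_self, swapHom_outside]
      · rw [swapSite_of_ne h, swapHom_site, swapSite_of_ne h]
    exact DFunLike.congr_fun this a
  · change swapHom j (swapHom j (tmul 1 b)) = tmul 1 b
    rw [swapHom_outside, swapHom_site, swapSite_self]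

theorem exists_isSwap (q : PosRat) : ∃ w, IsSwap q w :=
  ⟨StarAlgEquiv.ofStarAlgHom (swapHom (q, 0)) (swapHom (q, 0)) (swapHom_comp_self _)
    (swapHom_comp_self _), fun _ => (swapHom_site _ _ _ _).trans (swapSite_self _ _),
    swapHom_outside (q, 0), fun _ _ _ h => (swapHom_site _ _ _ _).trans (swapSite_of_ne h _)⟩

/-! ### Registers with an outside qubit -/

/-- The families of observables of the sites of all registers and of the outside qubit `none`. -/
abbrev FullFam : Type := FinFam fun _ : Option (PosRat × ℤ) => M₂

/-- Forget the outside qubit. -/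
def insideFam : FullFam →* SiteFam where
  toFun g := ⟨fun j => g.1 (some j), g.2.preimage (Option.some_injective _).injOn⟩
  map_one' := rfl
  map_mul' _ _ := rfl

theorem insideFam_apply (g : FullFam) (j : PosRat × ℤ) : (insideFam g).1 j = g.1 (some j) := rfl

/-- The elementary tensor of a family of observables of the sites and of the outside qubit. -/
noncomputable def fullTensor : FullFam →* MaxTensor Registers M₂ where
  toFun g := tmul (siteTensor (insideFam g)) (g.1 none)
  map_one' := by rw [map_one, map_one]; exact tmul_one_one _ _
  map_mul' g h := by
    rw [map_mul, map_mul, tmul_mul_tmul]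
    rfl

theorem fullTensor_apply (g : FullFam) :
    fullTensor g = tmul (siteTensor (insideFam g)) (g.1 none) := rfl

theorem fullTensor_updateAt_none (m : M₂) :
    fullTensor (updateAt (1 : FullFam) none m) = tmul 1 m := by
  rw [fullTensor_apply, updateAt_same]
  congr 1
  convert map_one siteTensor
  exact finFam_ext fun j => updateAt_ne _ _ (by simp)

theorem fullTensor_updateAt_some (j : PosRat × ℤ) (m : M₂) :
    fullTensor (updateAt (1 : FullFam) (some j) m) = tmul (site j.1 j.2 m) 1 := by
  rw [fullTensor_apply, updateAt_ne _ _ (by simp), ← siteTensor_updateAt_one]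
  congr 2
  refine finFam_ext fun k => ?_
  rw [insideFam_apply]
  by_cases h : k = j
  · subst h; rw [updateAt_same, updateAt_same]
  · rw [updateAt_ne _ _ h, updateAt_ne _ _ (by simpa using h)]
    rfl

/-- Permute the qubits. -/
def permFam (e : Equiv.Perm (Option (PosRat × ℤ))) : FullFam →* FullFam where
  toFun g := ⟨fun o => g.1 (e.symm o), g.2.preimage e.symm.injective.injOn⟩
  map_one' := rfl
  map_mul' _ _ := rfl

theorem permFam_updateAt_one (e : Equiv.Perm (Option (PosRat × ℤ))) (o : Option (PosRat × ℤ))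
    (m : M₂) : permFam e (updateAt 1 o m) = updateAt 1 (e o) m := by
  refine finFam_ext fun k => ?_
  change (updateAt (1 : FullFam) o m).1 (e.symm k) = _
  by_cases h : k = e o
  · subst h; rw [updateAt_same, e.symm_apply_apply, updateAt_same]
  · rw [updateAt_ne _ _ h, updateAt_ne _ _ fun h' => h (by rw [← h', e.apply_symm_apply])]
    rfl

open Classical in
/-- The shift of the sites of register `q`. -/
noncomputable def shiftPerm (q : PosRat) : Equiv.Perm (PosRat × ℤ) where
  toFun j := (j.1, if j.1 = q then j.2 + 1 else j.2)
  invFun j := (j.1, if j.1 = q then j.2 - 1 else j.2)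
  left_inv j := by
    refine Prod.ext rfl ?_
    by_cases h : j.1 = q <;> simp [h]
  right_inv j := by
    refine Prod.ext rfl ?_
    by_cases h : j.1 = q <;> simp [h]

open Classical in
/-- The permutation of the qubits which swaps site `0` of register `q` with the outside qubit and
then shifts register `q`. -/
noncomputable def swapShiftPerm (q : PosRat) : Equiv.Perm (Option (PosRat × ℤ)) :=
  (Equiv.swap none (some (q, 0))).trans (Equiv.optionCongr (shiftPerm q))

/-- The vectors of the qubit pairs: `|00⟩` for the outside pair. -/
noncomputable def fullVec : Option (PosRat × ℤ) → TwoQubit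
  | none => ket00
  | some j => siteVec j.1 j.2

/-- The outside qubit moves to site `0` and then to site `1`, the first site that carries `φ_q`. -/
theorem fullVec_swapShiftPerm_none (q : PosRat) : fullVec (swapShiftPerm q none) = phi q := by
  simp [swapShiftPerm, shiftPerm, fullVec, siteVec]

/-- The catalyst is unharmed: site `0` goes to the outside pair, also in `|00⟩`, and for `i ≠ 0` the
conditions `i ≤ 0` and `i + 1 ≤ 0` agree. -/
theorem fullVec_swapShiftPerm_some (q : PosRat) (j : PosRat × ℤ) :
    fullVec (swapShiftPerm q (some j)) = siteVec j.1 j.2 := by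
  obtain ⟨p, i⟩ := j
  by_cases h : (p, i) = (q, 0)
  · rw [h]
    simp [swapShiftPerm, fullVec, siteVec]
  · rw [swapShiftPerm, Equiv.trans_apply, Equiv.swap_apply_of_ne_of_ne (by simp) (by simpa using h)]
    change siteVec p (if p = q then i + 1 else i) = siteVec p i
    split_ifs with hp
    · have hi : i ≠ 0 := fun hi => h (by rw [hp, hi])
      unfold siteVec
      congr 1
      exact propext ⟨fun _ => by omega, fun _ => by omega⟩
    · rfl

section Action

variable {q : PosRat} {σ : CAR ≃⋆ₐ[ℂ] CAR} {τ : Registers ≃⋆ₐ[ℂ] Registers}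
  {w α : MaxTensor Registers M₂ ≃⋆ₐ[ℂ] MaxTensor Registers M₂}

theorem IsSwap.fullTensor_updateAt [DecidableEq (Option (PosRat × ℤ))] (hw : IsSwap q w)
    (o : Option (PosRat × ℤ)) (m : M₂) :
    w (fullTensor (updateAt 1 o m)) =
      fullTensor (updateAt 1 (Equiv.swap none (some (q, 0)) o) m) := by
  rcases o with _ | ⟨p, i⟩
  · rw [Equiv.swap_apply_left, fullTensor_updateAt_none, fullTensor_updateAt_some, hw.2.1]
  · by_cases h : (p, i) = (q, 0)
    · rw [h, Equiv.swap_apply_right, fullTensor_updateAt_none, fullTensor_updateAt_some, hw.1]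
    · rw [Equiv.swap_apply_of_ne_of_ne (by simp) (by simpa using h), fullTensor_updateAt_some,
        hw.2.2 p i m h]

theorem shift_fullTensor_updateAt (hσ : IsShift σ) (hτ : IsOnRegister q σ τ)
    (o : Option (PosRat × ℤ)) (m : M₂) :
    tensorMap (τ : Registers →⋆ₐ[ℂ] Registers) (StarAlgHom.id ℂ M₂)
      (fullTensor (updateAt 1 o m)) =
      fullTensor (updateAt 1 (Equiv.optionCongr (shiftPerm q) o) m) := by
  rcases o with _ | ⟨p, i⟩
  · rw [Equiv.optionCongr_apply, Option.map_none, fullTensor_updateAt_none, tensorMap_tmul, map_one]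
    rfl
  · rw [Equiv.optionCongr_apply, Option.map_some, fullTensor_updateAt_some,
      fullTensor_updateAt_some, tensorMap_tmul, map_one]
    congr 1
    change τ (site p i m) = site p (if p = q then i + 1 else i) m
    rw [site, hτ p, site]
    congr 1
    split_ifs with h
    · exact hσ i m
    · rfl

/-- Both sides are monoid homomorphisms in `g`, so it is enough to follow one observable at one
qubit. -/
theorem swapShift_fullTensor (hσ : IsShift σ) (hτ : IsOnRegister q σ τ) (hw : IsSwap q w)
    (hα : ∀ x, α x = tensorMap (τ : Registers →⋆ₐ[ℂ] Registers) (StarAlgHom.id ℂ M₂) (w x))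
    (g : FullFam) : α (fullTensor g) = fullTensor (permFam (swapShiftPerm q) g) := by
  classical
  have : (α : MaxTensor Registers M₂ →* MaxTensor Registers M₂).comp fullTensor =
      fullTensor.comp (permFam (swapShiftPerm q)) := finFam_hom_ext fun o m => by
    change α (fullTensor _) = fullTensor (permFam _ _)
    rw [hα, hw.fullTensor_updateAt, shift_fullTensor_updateAt hσ hτ, permFam_updateAt_one,
      swapShiftPerm, Equiv.trans_apply]
  exact DFunLike.congr_fun this g

end Action

/-! ### Embezzlement -/

section TmulLinear

variable {A B D : Type u} [CStarAlgebra A] [CStarAlgebra B] [CStarAlgebra D]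

/-- `a ↦ a ⊗ b` as a linear map. -/
noncomputable def tmulLeft (b : B) : A →ₗ[ℂ] MaxTensor A B :=
  LinearMap.mulRight ℂ (inrHom A B b) ∘ₗ (inlHom A B : A →ₐ[ℂ] MaxTensor A B).toLinearMap

theorem tmulLeft_apply (a : A) (b : B) : tmulLeft b a = tmul a b := (tmul_eq_mul a b).symm

/-- `b ↦ a ⊗ b` as a linear map. -/
noncomputable def tmulRight (a : A) : B →ₗ[ℂ] MaxTensor A B :=
  LinearMap.mulLeft ℂ (inlHom A B a) ∘ₗ (inrHom A B : B →ₐ[ℂ] MaxTensor A B).toLinearMap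

theorem tmulRight_apply (a : A) (b : B) : tmulRight a b = tmul a b := (tmul_eq_mul a b).symm

theorem MaxTensor.commute_hom {φ : MaxTensor A B →⋆ₐ[ℂ] D} {d : D}
    (hl : ∀ a, Commute d (φ (tmul a 1))) (hr : ∀ b, Commute d (φ (tmul 1 b)))
    (x : MaxTensor A B) : Commute d (φ x) := by
  induction x using MaxTensor.induction with
  | hc =>
    exact isClosed_eq (continuous_const.mul (map_continuous φ))
      ((map_continuous φ).mul continuous_const)
  | h0 => rw [map_zero]; exact Commute.zero_right _
  | hadd x y hx hy => rw [map_add]; exact hx.add_right hy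
  | htmul a b =>
    rw [tmul_eq_mul, map_mul]
    exact (hl a).mul_right (hr b)

/-- The bilinear map `(a, b) ↦ S (f a ⊗ g b)`. -/
noncomputable def tmulBilin {X Y : Type u} [CStarAlgebra X] [CStarAlgebra Y]
    (S : MaxTensor X Y →ₗ[ℂ] ℂ) (f : A →ₗ[ℂ] X) (g : B →ₗ[ℂ] Y) : A →ₗ[ℂ] B →ₗ[ℂ] ℂ :=
  LinearMap.mk₂ ℂ (fun a b => S (tmul (f a) (g b)))
    (fun _ _ _ => by simp only [← tmulLeft_apply, map_add])
    (fun _ _ _ => by simp only [← tmulLeft_apply, map_smul])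
    (fun _ _ _ => by simp only [← tmulRight_apply, map_add])
    (fun _ _ _ => by simp only [← tmulRight_apply, map_smul])

theorem continuous_tmulBilin_left {X Y : Type u} [CStarAlgebra X] [CStarAlgebra Y]
    {S : MaxTensor X Y →ₗ[ℂ] ℂ} (hS : Continuous S) {f : A →ₗ[ℂ] X} (hf : Continuous f)
    (g : B →ₗ[ℂ] Y) (b : B) : Continuous fun a => tmulBilin S f g a b :=
  hS.comp ((continuous_tmul_left (g b)).comp hf)

theorem continuous_tmulBilin_right {X Y : Type u} [CStarAlgebra X] [CStarAlgebra Y]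
    {S : MaxTensor X Y →ₗ[ℂ] ℂ} (hS : Continuous S) (f : A →ₗ[ℂ] X) {g : B →ₗ[ℂ] Y}
    (hg : Continuous g) (a : A) : Continuous fun b => tmulBilin S f g a b :=
  hS.comp ((continuous_tmul_right (f a)).comp hg)

/-- `a ↦ α (a ⊗ m)` as a linear map. -/
noncomputable def tmulThen (α : MaxTensor A B ≃⋆ₐ[ℂ] D) (m : B) : A →ₗ[ℂ] D :=
  (α : MaxTensor A B →ₐ[ℂ] D).toLinearMap ∘ₗ tmulLeft m

theorem tmulThen_apply (α : MaxTensor A B ≃⋆ₐ[ℂ] D) (m : B) (a : A) :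
    tmulThen α m a = α (tmul a m) :=
  congrArg α (tmulLeft_apply a m)

theorem continuous_tmulThen (α : MaxTensor A B ≃⋆ₐ[ℂ] D) (m : B) : Continuous (tmulThen α m) := by
  simp only [funext (tmulThen_apply α m)]
  exact (map_continuous α).comp (continuous_tmul_left m)

/-- A criterion for embezzlement on elementary tensors. -/
theorem embezzles_of_forall_tmul {A B : Type} [CStarAlgebra A] [CStarAlgebra B]
    {s : MaxTensor A B →ₗ[ℂ] ℂ} {S : MaxTensor (MaxTensor A M₂) (MaxTensor B M₂) →ₗ[ℂ] ℂ}
    (hS : IsState S) (h0 : ∀ a b m n, S (tmul (tmul a m) (tmul b n)) = s (tmul a b) * (s₀ m * s₀ n))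
    {α : MaxTensor A M₂ ≃⋆ₐ[ℂ] MaxTensor A M₂} {β : MaxTensor B M₂ ≃⋆ₐ[ℂ] MaxTensor B M₂}
    {φ : TwoQubit}
    (h : ∀ a b m n, S (tmul (α (tmul a m)) (β (tmul b n))) = s (tmul a b) * vectorState φ m n) :
    Embezzles s α β φ := by
  -- The target state `T` is taken to be `S ∘ (α ⊗ β)`, automatically a state; what remains is to
  -- identify its values on elementary tensors.
  refine ⟨S, _, hS, h0, hS.comp (tensorMap (α : MaxTensor A M₂ →⋆ₐ[ℂ] MaxTensor A M₂)
    (β : MaxTensor B M₂ →⋆ₐ[ℂ] MaxTensor B M₂)), fun a b m n => ?_, fun X => rfl⟩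
  rw [← h]
  exact congrArg S (tensorMap_tmul _ _ _ _)

end TmulLinear

/-- Separate continuity suffices, since density is used in one variable at a time. -/
theorem Registers.bilinear_ext {Φ Ψ : Registers →ₗ[ℂ] Registers →ₗ[ℂ] ℂ}
    (hΦ : ∀ b, Continuous fun a => Φ a b) (hΨ : ∀ b, Continuous fun a => Ψ a b)
    (hΦ' : ∀ a, Continuous fun b => Φ a b) (hΨ' : ∀ a, Continuous fun b => Ψ a b)
    (h : ∀ f g, Φ (siteTensor f) (siteTensor g) = Ψ (siteTensor f) (siteTensor g)) : Φ = Ψ := by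
  have h1 (g : SiteFam) : Φ.flip (siteTensor g) = Ψ.flip (siteTensor g) :=
    Registers.linear_ext (hΦ _) (hΨ _) fun f => h f g
  exact LinearMap.ext fun a => Registers.linear_ext (hΦ' a) (hΨ' a) fun g =>
    DFunLike.congr_fun (h1 g) a

theorem Registers.tmul_ext {X Y : Type} [CStarAlgebra X] [CStarAlgebra Y]
    {S : MaxTensor X Y →ₗ[ℂ] ℂ} (hS : Continuous S) {s : MaxTensor Registers Registers →ₗ[ℂ] ℂ}
    (hs : Continuous s) {f : Registers →ₗ[ℂ] X} (hf : Continuous f) {g : Registers →ₗ[ℂ] Y}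
    (hg : Continuous g) (h : ∀ k l, S (tmul (f (siteTensor k)) (g (siteTensor l))) =
      s (tmul (siteTensor k) (siteTensor l))) (a b : Registers) :
    S (tmul (f a) (g b)) = s (tmul a b) := by
  have key : tmulBilin S f g = tmulBilin s LinearMap.id LinearMap.id :=
    Registers.bilinear_ext (fun b => continuous_tmulBilin_left hS hf g b)
      (fun b => continuous_tmulBilin_left hs continuous_id LinearMap.id b)
      (fun a => continuous_tmulBilin_right hS f hg a)
      (fun a => continuous_tmulBilin_right hs LinearMap.id continuous_id a) h
  exact LinearMap.congr_fun₂ key a b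

theorem vectorState_ket00 (m n : M₂) : vectorState ket00 m n = s₀ m * s₀ n := by
  simp [vectorState, ket00, s₀, Fin.sum_univ_two]

section Initial

variable {A B : Type} [CStarAlgebra A] [CStarAlgebra B]

/-- The two parties, each with its outside qubit, act by commuting maps on `(A ⊗ B) ⊗ 𝕄₄`; pulling a
product state back along them reorders the factors. -/
theorem commute_tensorMap_qubits (x : MaxTensor A M₂) (y : MaxTensor B M₂) :
    Commute (tensorMap (inlHom A B) leftQubit x) (tensorMap (inrHom A B) rightQubit y) := by
  refine MaxTensor.commute_hom (fun b => ?_) (fun n => ?_) y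
  all_goals
    refine (MaxTensor.commute_hom (fun a => ?_) (fun m => ?_) x).symm
  all_goals
    simp only [tensorMap_tmul, map_one, Commute, SemiconjBy, tmul_mul_tmul, one_mul, mul_one]
  · rw [inlHom_apply, inrHom_apply, (commute_inl_inr a b).eq]
  · rw [(commute_leftQubit_rightQubit m n).eq]

/-- The product of a state with the vector state `s_φ` of the outside qubits. -/
theorem exists_state_tensor_vectorState {s : MaxTensor A B →ₗ[ℂ] ℂ} (hs : IsState s) {φ : TwoQubit}
    (hφ : ‖φ‖ = 1) : ∃ S : MaxTensor (MaxTensor A M₂) (MaxTensor B M₂) →ₗ[ℂ] ℂ,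
      IsState S ∧ Continuous S ∧ ∀ a b m n,
        S (tmul (tmul a m) (tmul b n)) = s (tmul a b) * vectorState φ m n := by
  obtain ⟨F, hF, hFc, hFg⟩ := MaxTensor.exists_product_state hs (vectorFunctional_isState hφ)
  refine ⟨_, hF.comp (maxLift _ _ commute_tensorMap_qubits),
    hFc.comp (map_continuous (maxLift _ _ commute_tensorMap_qubits)), fun a b m n => ?_⟩
  change F (maxLift _ _ commute_tensorMap_qubits _) = _
  rw [maxLift_tmul, tensorMap_tmul, tensorMap_tmul, tmul_mul_tmul, hFg, vectorFunctional_mul,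
    inlHom_apply, inrHom_apply, tmul_mul_tmul, mul_one, one_mul]

end Initial

section Rotation

-- Moving `U ⊗ V` from the vector to the observable: `⟨Wφ| M |Wφ⟩ = ⟨φ| W* M W |φ⟩` with `W = U ⊗
-- V`.
open Matrix in
theorem vectorState_localAct (U V : M₂) (φ : TwoQubit) (m n : M₂) :
    vectorState (localAct U V φ) m n = vectorState φ (star U * m * U) (star V * n * V) := by
  rw [← vectorFunctional_mul, ← vectorFunctional_mul, leftQubit_mul_rightQubit,
    leftQubit_mul_rightQubit, ← kron_mul_kron, ← kron_mul_kron, ← star_kron]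
  have key (ψ : TwoQubit) (M : M₄) : vectorFunctional ψ M =
      star (fun x => ψ x) ⬝ᵥ (CStarMatrix.ofMatrix.symm M *ᵥ fun x => ψ x) := by
    simp only [vectorFunctional_apply, dotProduct, mulVec, Finset.mul_sum, Pi.star_apply, mul_assoc]
    rfl
  have hact : (fun x => localAct U V φ x) =
      CStarMatrix.ofMatrix.symm (kron U V) *ᵥ fun x => φ x := by
    ext x
    simp only [mulVec, dotProduct, Fintype.sum_prod_type]
    rfl
  rw [key, key, hact, star_mulVec, ← dotProduct_mulVec, mulVec_mulVec, mulVec_mulVec]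
  rfl

end Rotation

section Embezzle

variable {t : PosRat → MaxTensor CAR CAR →ₗ[ℂ] ℂ} {s : MaxTensor Registers Registers →ₗ[ℂ] ℂ}
  {S : MaxTensor (MaxTensor Registers M₂) (MaxTensor Registers M₂) →ₗ[ℂ] ℂ}

theorem finprod_fullFam {v : Option (PosRat × ℤ) → TwoQubit}
    (hv : ∀ j, v (some j) = siteVec j.1 j.2) (g h : FullFam) :
    ∏ᶠ o, vectorState (v o) (g.1 o) (h.1 o) = vectorState (v none) (g.1 none) (h.1 none) *
      ∏ᶠ j : PosRat × ℤ, vectorState (siteVec j.1 j.2) ((insideFam g).1 j) ((insideFam h).1 j) := by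
  have hj (j : PosRat × ℤ) : vectorState (v (some j)) (g.1 (some j)) (h.1 (some j)) =
      vectorState (siteVec j.1 j.2) ((insideFam g).1 j) ((insideFam h).1 j) := by
    rw [hv]; rfl
  rw [finprod_option]
  · simp only [hj]
  · change Function.HasFiniteMulSupport fun j => vectorState (v (some j)) _ _
    simp only [hj]
    exact hasFiniteMulSupport_siteVec _ _

/-- Reindexing transfers the permutation from the observables to the vectors, where its effect is
known. -/
theorem finprod_permFam (q : PosRat) (g h : FullFam) :
    ∏ᶠ o, vectorState (fullVec o) ((permFam (swapShiftPerm q) g).1 o)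
        ((permFam (swapShiftPerm q) h).1 o) =
      ∏ᶠ o, vectorState (fullVec (swapShiftPerm q o)) (g.1 o) (h.1 o) := by
  rw [← finprod_comp_equiv (swapShiftPerm q)]
  refine finprod_congr fun o => ?_
  change vectorState _ (g.1 ((swapShiftPerm q).symm (swapShiftPerm q o)))
    (h.1 ((swapShiftPerm q).symm (swapShiftPerm q o))) = _
  rw [Equiv.symm_apply_apply]

theorem state_fullTensor (ht : ∀ q, IsRegisterState q (t q)) (hs : IsProductState t s)
    (hS : ∀ a b m n, S (tmul (tmul a m) (tmul b n)) = s (tmul a b) * vectorState ket00 m n)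
    (g h : FullFam) : S (tmul (fullTensor g) (fullTensor h)) =
      ∏ᶠ o, vectorState (fullVec o) (g.1 o) (h.1 o) := by
  have e : s (tmul (siteTensor (insideFam g)) (siteTensor (insideFam h))) *
      vectorState ket00 (g.1 none) (h.1 none) =
        ∏ᶠ o, vectorState (fullVec o) (g.1 o) (h.1 o) := by
    rw [productState_siteTensor ht hs, mul_comm]
    exact (finprod_fullFam (v := fullVec) (fun _ => rfl) g h).symm
  exact (hS _ _ _ _).trans e

variable {q : PosRat} {α : MaxTensor Registers M₂ ≃⋆ₐ[ℂ] MaxTensor Registers M₂}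

/-- The family with the observables `g` of the sites and `m` of the outside qubit. -/
def fullFam (g : SiteFam) (m : M₂) : FullFam :=
  ⟨fun o => o.elim m g.1, ((g.2.image some).insert none).subset (by
    rintro (_ | j) hj
    · exact Set.mem_insert _ _
    · exact Set.mem_insert_of_mem _ ⟨j, hj, rfl⟩)⟩

theorem insideFam_fullFam (g : SiteFam) (m : M₂) : insideFam (fullFam g m) = g := rfl

theorem fullFam_none (g : SiteFam) (m : M₂) : (fullFam g m).1 none = m := rfl

theorem fullTensor_fullFam (g : SiteFam) (m : M₂) :
    fullTensor (fullFam g m) = tmul (siteTensor g) m := by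
  rw [fullTensor_apply, insideFam_fullFam, fullFam_none]

theorem finprod_permFam_fullFam (q : PosRat) (f g : SiteFam) (m n : M₂) :
    ∏ᶠ o, vectorState (fullVec o) ((permFam (swapShiftPerm q) (fullFam f m)).1 o)
        ((permFam (swapShiftPerm q) (fullFam g n)).1 o) = vectorState (phi q) m n *
      ∏ᶠ j : PosRat × ℤ, vectorState (siteVec j.1 j.2) (f.1 j) (g.1 j) := by
  rw [finprod_permFam, finprod_fullFam (v := fun o => fullVec (swapShiftPerm q o))
    (fullVec_swapShiftPerm_some q), fullVec_swapShiftPerm_none, fullFam_none, fullFam_none,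
    insideFam_fullFam, insideFam_fullFam]

theorem embezzled_siteTensor (ht : ∀ q, IsRegisterState q (t q)) (hs : IsProductState t s)
    (hS : ∀ a b m n, S (tmul (tmul a m) (tmul b n)) = s (tmul a b) * vectorState ket00 m n)
    (hα : ∀ g, α (fullTensor g) = fullTensor (permFam (swapShiftPerm q) g)) (f g : SiteFam)
    (m n : M₂) : S (tmul (α (tmul (siteTensor f) m)) (α (tmul (siteTensor g) n))) =
      s (tmul (siteTensor f) (siteTensor g)) * vectorState (phi q) m n := by
  have e (g : SiteFam) (m : M₂) : α (tmul (siteTensor g) m) =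
      fullTensor (permFam (swapShiftPerm q) (fullFam g m)) :=
    (congrArg α (fullTensor_fullFam g m).symm).trans (hα _)
  refine (congrArg₂ (fun x y => S (tmul x y)) (e f m) (e g n)).trans
    ((state_fullTensor ht hs hS _ _).trans ((finprod_permFam_fullFam q f g m n).trans ?_))
  rw [productState_siteTensor ht hs, mul_comm]

/-- For fixed `m` and `n` both sides are bilinear and separately continuous in `a` and `b`, so the
case of site tensors suffices. -/
theorem embezzled_tmul (ht : ∀ q, IsRegisterState q (t q)) (hs : IsProductState t s)
    (hsc : Continuous s) (hSc : Continuous S)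
    (hS : ∀ a b m n, S (tmul (tmul a m) (tmul b n)) = s (tmul a b) * vectorState ket00 m n)
    (hα : ∀ g, α (fullTensor g) = fullTensor (permFam (swapShiftPerm q) g))
    (a b : Registers) (m n : M₂) :
    S (tmul (α (tmul a m)) (α (tmul b n))) = s (tmul a b) * vectorState (phi q) m n := by
  have e (a b : Registers) : S (tmul (tmulThen α m a) (tmulThen α n b)) =
      S (tmul (α (tmul a m)) (α (tmul b n))) :=
    congrArg₂ (fun x y => S (tmul x y)) (tmulThen_apply α m a) (tmulThen_apply α n b)
  have hc : Continuous (vectorState (phi q) m n • s) := hsc.const_smul _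
  have e' (x : MaxTensor Registers Registers) :
      s x * vectorState (phi q) m n = (vectorState (phi q) m n • s) x := mul_comm _ _
  have hsite (f g : SiteFam) : S (tmul (tmulThen α m (siteTensor f)) (tmulThen α n (siteTensor g)))
      = (vectorState (phi q) m n • s) (tmul (siteTensor f) (siteTensor g)) :=
    (e _ _).trans ((embezzled_siteTensor ht hs hS hα f g m n).trans (e' _))
  exact (e a b).symm.trans ((Registers.tmul_ext hSc hc (continuous_tmulThen α m)
    (continuous_tmulThen α n) hsite a b).trans (e' _).symm)

end Embezzle

/-! ### The target states -/

section Targets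

open Matrix

theorem localAct_apply (U V : M₂) (φ : TwoQubit) (x : Fin 2 × Fin 2) :
    localAct U V φ x = ∑ k, ∑ l, U x.1 k * V x.2 l * φ (k, l) := rfl

theorem vectorState_one_one_eq_norm_sq (φ : TwoQubit) :
    vectorState φ 1 1 = ((‖φ‖ ^ 2 : ℝ) : ℂ) := by
  rw [EuclideanSpace.norm_sq_eq, Fintype.sum_prod_type, vectorState]
  simp only [Fin.sum_univ_two, CStarMatrix.one_apply]
  simp [Complex.conj_mul']

/-- The squared norm is the expectation of `1 ⊗ 1`, which conjugation by unitaries fixes. -/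
theorem norm_localAct (U V : unitary M₂) (φ : TwoQubit) :
    ‖localAct (U : M₂) (V : M₂) φ‖ = ‖φ‖ := by
  have h : vectorState (localAct (U : M₂) (V : M₂) φ) 1 1 = vectorState φ 1 1 := by
    rw [vectorState_localAct, mul_one, mul_one, (Unitary.mem_iff.mp U.2).1,
      (Unitary.mem_iff.mp V.2).1]
  rw [vectorState_one_one_eq_norm_sq, vectorState_one_one_eq_norm_sq, Complex.ofReal_inj] at h
  exact (sq_eq_sq₀ (norm_nonneg _) (norm_nonneg _)).mp h

theorem det_ne_zero_of_unitary (U : unitary M₂) :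
    (U : M₂) 0 0 * (U : M₂) 1 1 - (U : M₂) 0 1 * (U : M₂) 1 0 ≠ 0 := by
  intro h
  have h1 : Matrix.det (CStarMatrix.ofMatrix.symm (star (U : M₂) * (U : M₂))) = 1 := by
    rw [(Unitary.mem_iff.mp U.2).1]
    exact Matrix.det_one
  have h2 : Matrix.det (CStarMatrix.ofMatrix.symm (star (U : M₂) * (U : M₂))) =
      Matrix.det (CStarMatrix.ofMatrix.symm (star (U : M₂))) *
        Matrix.det (CStarMatrix.ofMatrix.symm (U : M₂)) := Matrix.det_mul _ _
  have h3 : Matrix.det (CStarMatrix.ofMatrix.symm (U : M₂)) = 0 :=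
    (Matrix.det_fin_two _).trans h
  rw [h2, h3, mul_zero] at h1
  exact zero_ne_one h1

theorem targetStates_subset_entangledStates : targetStates ⊆ entangledStates := by
  rintro _ ⟨q, U, V, rfl⟩
  refine ⟨by rw [norm_localAct, norm_phi], ?_⟩
  rintro ⟨u, v, h⟩
  have hq : (0 : ℝ) < q.1 := by exact_mod_cast q.2
  -- The coefficient matrix of `(U ⊗ V) φ` is `U Φ Vᵀ`, so its determinant is `det U · det V · det
  -- Φ`, here nonzero; a product vector has a coefficient matrix of determinant zero.
  have hdet : localAct (U : M₂) (V : M₂) (phi q) (0, 0) * localAct (U : M₂) (V : M₂) (phi q) (1, 1) -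
      localAct (U : M₂) (V : M₂) (phi q) (0, 1) * localAct (U : M₂) (V : M₂) (phi q) (1, 0) =
      ((U : M₂) 0 0 * (U : M₂) 1 1 - (U : M₂) 0 1 * (U : M₂) 1 0) *
      ((V : M₂) 0 0 * (V : M₂) 1 1 - (V : M₂) 0 1 * (V : M₂) 1 0) *
      (phi q (0, 0) * phi q (1, 1) - phi q (0, 1) * phi q (1, 0)) := by
    simp only [localAct_apply, Fin.sum_univ_two]
    ring
  have hphi : phi q (0, 0) * phi q (1, 1) - phi q (0, 1) * phi q (1, 0) ≠ 0 := by
    simp only [phi_apply, Prod.mk.injEq, one_ne_zero, zero_ne_one, and_self, and_false, false_and,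
      if_true, if_false, mul_zero, sub_zero]
    refine mul_ne_zero ?_ ?_ <;> rw [Complex.ofReal_ne_zero, Real.sqrt_ne_zero'] <;> positivity
  refine mul_ne_zero (mul_ne_zero (det_ne_zero_of_unitary U) (det_ne_zero_of_unitary V)) hphi
    (hdet.symm.trans ?_)
  rw [h, h, h, h]
  ring

/-- A unit vector in `ℂ²` and a phase define a unitary matrix. -/
theorem exists_unitary {w₀ w₁ e : ℂ} (hw : star w₀ * w₀ + star w₁ * w₁ = 1) (he : star e * e = 1) :
    ∃ U : unitary M₂, (U : M₂) 0 0 = w₀ ∧ (U : M₂) 1 0 = w₁ ∧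
      (U : M₂) 0 1 = -(e * star w₁) ∧ (U : M₂) 1 1 = e * star w₀ := by
  let U : M₂ := CStarMatrix.ofMatrix !![w₀, -(e * star w₁); w₁, e * star w₀]
  have h00 : U 0 0 = w₀ := rfl
  have h10 : U 1 0 = w₁ := rfl
  have h01 : U 0 1 = -(e * star w₁) := rfl
  have h11 : U 1 1 = e * star w₀ := rfl
  refine ⟨⟨U, Unitary.mem_iff.mpr ⟨?_, ?_⟩⟩, h00, h10, h01, h11⟩
  · ext i j
    fin_cases i <;> fin_cases j <;>
      simp only [CStarMatrix.mul_apply, CStarMatrix.star_apply, Fin.sum_univ_two, Fin.zero_eta,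
        Fin.mk_one, h00, h10, h01, h11, CStarMatrix.one_apply, if_true, zero_ne_one, one_ne_zero,
        if_false, star_neg, star_mul', star_star]
    · exact hw
    · ring
    · ring
    · linear_combination star e * e * hw + he
  · ext i j
    fin_cases i <;> fin_cases j <;>
      simp only [CStarMatrix.mul_apply, CStarMatrix.star_apply, Fin.sum_univ_two, Fin.zero_eta,
        Fin.mk_one, h00, h10, h01, h11, CStarMatrix.one_apply, if_true, zero_ne_one, one_ne_zero,
        if_false, star_neg, star_mul', star_star]
    · linear_combination hw + star w₁ * w₁ * he
    · linear_combination -w₀ * star w₁ * he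
    · linear_combination -w₁ * star w₀ * he
    · linear_combination hw + star w₀ * w₀ * he

-- Take `w` a unit eigenvector of `A* A` with eigenvalue `λ ≠ 0`. For `w'` orthogonal to `w` one has
-- `⟨A w, A w'⟩ = ⟨A* A w, w'⟩ = λ ⟨w, w'⟩ = 0`.
open scoped ComplexOrder in
theorem exists_orthogonal_images {A : Matrix (Fin 2) (Fin 2) ℂ} (hA : A ≠ 0) :
    ∃ w : Fin 2 → ℂ, star (w 0) * w 0 + star (w 1) * w 1 = 1 ∧ A *ᵥ w ≠ 0 ∧
      star (A *ᵥ w) ⬝ᵥ (A *ᵥ ![-star (w 1), star (w 0)]) = 0 := by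
  have hH := Matrix.isHermitian_conjTranspose_mul_self A
  have h0 : hH.eigenvalues ≠ 0 := fun h =>
    hA (Matrix.conjTranspose_mul_self_eq_zero.mp (hH.eigenvalues_eq_zero_iff.mp h))
  obtain ⟨j, hj⟩ := Function.ne_iff.mp h0
  let w : Fin 2 → ℂ := ⇑(hH.eigenvectorBasis j)
  have hw : (Aᴴ * A) *ᵥ w = hH.eigenvalues j • w := hH.mulVec_eigenvectorBasis j
  refine ⟨w, ?_, fun hx => ?_, ?_⟩
  · have h := hH.eigenvectorBasis.orthonormal.1 j
    have h' : ‖hH.eigenvectorBasis j‖ ^ 2 = 1 := by rw [h, one_pow]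
    rw [EuclideanSpace.norm_sq_eq, Fin.sum_univ_two] at h'
    have := congrArg (fun x : ℝ => (x : ℂ)) h'
    push_cast at this
    rw [Complex.star_def, Complex.conj_mul', Complex.conj_mul']
    exact this
  · rw [← mulVec_mulVec, hx, mulVec_zero] at hw
    have hw0 : w = 0 := (smul_eq_zero.mp hw.symm).resolve_left hj
    have h := hH.eigenvectorBasis.orthonormal.1 j
    have : hH.eigenvectorBasis j = 0 := by
      ext i; exact congrFun hw0 i
    rw [this, norm_zero] at h
    exact zero_ne_one h
  · have h : star (A *ᵥ w) ⬝ᵥ (A *ᵥ ![-star (w 1), star (w 0)]) =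
        star ((Aᴴ * A) *ᵥ w) ⬝ᵥ ![-star (w 1), star (w 0)] := by
      rw [star_mulVec, star_mulVec, conjTranspose_mul, conjTranspose_conjTranspose,
        ← dotProduct_mulVec, ← dotProduct_mulVec, mulVec_mulVec]
    rw [h, hw]
    simp [dotProduct, Fin.sum_univ_two]
    ring

/-- The vector `c |00⟩ + d |11⟩`. -/
noncomputable def schmidtVec (c d : ℝ) : TwoQubit :=
  WithLp.toLp 2 fun x => if x = (0, 0) then (c : ℂ) else if x = (1, 1) then (d : ℂ) else 0

theorem schmidtVec_apply (c d : ℝ) (x : Fin 2 × Fin 2) : schmidtVec c d x =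
    if x = (0, 0) then (c : ℂ) else if x = (1, 1) then (d : ℂ) else 0 := rfl

theorem localAct_schmidtVec (U V : M₂) (c d : ℝ) (x : Fin 2 × Fin 2) :
    localAct U V (schmidtVec c d) x = U x.1 0 * V x.2 0 * c + U x.1 1 * V x.2 1 * d := by
  simp [localAct_apply, schmidtVec_apply, Fin.sum_univ_two]

theorem norm_schmidtVec_sq (c d : ℝ) : ‖schmidtVec c d‖ ^ 2 = c ^ 2 + d ^ 2 := by
  rw [EuclideanSpace.norm_sq_eq, Fintype.sum_prod_type]
  simp [schmidtVec_apply, Fin.sum_univ_two]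

/-- The Schmidt decomposition. -/
theorem exists_schmidt {φ : TwoQubit} (hφ : φ ≠ 0) : ∃ (U V : unitary M₂) (c d : ℝ), 0 ≤ c ∧ 0 ≤ d ∧
    φ = localAct (U : M₂) (V : M₂) (schmidtVec c d) := by
  let A : Matrix (Fin 2) (Fin 2) ℂ := Matrix.of fun i j => φ (i, j)
  have hA : A ≠ 0 := fun h => hφ (by
    ext ⟨i, j⟩
    exact congrFun (congrFun h i) j)
  obtain ⟨w, hw, hx, hxy⟩ := exists_orthogonal_images hA
  set x := A *ᵥ w with hxdef
  set y := A *ᵥ ![-star (w 1), star (w 0)] with hydef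
  obtain ⟨c, hc, hcx⟩ : ∃ c : ℝ, 0 < c ∧ star (x 0) * x 0 + star (x 1) * x 1 = (c : ℂ) ^ 2 := by
    have hpos : 0 < ‖x 0‖ ^ 2 + ‖x 1‖ ^ 2 := by
      by_contra h
      have h0 : ‖x 0‖ = 0 := by nlinarith [sq_nonneg ‖x 0‖, sq_nonneg ‖x 1‖]
      have h1 : ‖x 1‖ = 0 := by nlinarith [sq_nonneg ‖x 0‖, sq_nonneg ‖x 1‖]
      refine hx (funext fun i => ?_)
      fin_cases i
      · exact norm_eq_zero.mp h0
      · exact norm_eq_zero.mp h1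
    refine ⟨√(‖x 0‖ ^ 2 + ‖x 1‖ ^ 2), Real.sqrt_pos.mpr hpos, ?_⟩
    rw [← Complex.ofReal_pow, Real.sq_sqrt hpos.le, Complex.star_def, Complex.conj_mul',
      Complex.conj_mul']
    push_cast
    rfl
  have hc0 : (c : ℂ) ≠ 0 := Complex.ofReal_ne_zero.mpr hc.ne'
  obtain ⟨u₀, hu₀⟩ : ∃ u, x 0 = c * u := ⟨x 0 / c, by field_simp⟩
  obtain ⟨u₁, hu₁⟩ : ∃ u, x 1 = c * u := ⟨x 1 / c, by field_simp⟩
  have hu : star u₀ * u₀ + star u₁ * u₁ = 1 := by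
    rw [hu₀, hu₁] at hcx
    simp only [star_mul', Complex.star_def, Complex.conj_ofReal] at hcx ⊢
    refine mul_left_cancel₀ (pow_ne_zero 2 hc0) ?_
    linear_combination hcx
  have horth : star u₀ * y 0 + star u₁ * y 1 = 0 := by
    rw [dotProduct, Fin.sum_univ_two, Pi.star_apply, Pi.star_apply, hu₀, hu₁] at hxy
    simp only [star_mul', Complex.star_def, Complex.conj_ofReal] at hxy ⊢
    refine mul_left_cancel₀ hc0 ?_
    linear_combination hxy
  -- In `ℂ²` the vector `y`, orthogonal to `u`, is a multiple of `(-star u₁, star u₀)`. The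
  -- coefficient is the determinant of `(u, y)`; its phase `e` is absorbed into the second column of
  -- `U`.
  obtain ⟨d, e, hd, he, hde⟩ : ∃ (d : ℝ) (e : ℂ), 0 ≤ d ∧ star e * e = 1 ∧
      u₀ * y 1 - u₁ * y 0 = d * e := by
    refine ⟨‖u₀ * y 1 - u₁ * y 0‖, Complex.exp (Complex.arg (u₀ * y 1 - u₁ * y 0) * Complex.I),
      norm_nonneg _, ?_, (Complex.norm_mul_exp_arg_mul_I _).symm⟩
    rw [Complex.star_def, Complex.conj_mul', Complex.norm_exp_ofReal_mul_I]
    norm_num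
  have hy₀ : y 0 = -(d * e * star u₁) := by
    rw [← hde]
    linear_combination -y 0 * hu + u₀ * horth
  have hy₁ : y 1 = d * e * star u₀ := by
    rw [← hde]
    linear_combination -y 1 * hu + u₁ * horth
  obtain ⟨U, hU00, hU10, hU01, hU11⟩ := exists_unitary hu he
  -- `V` is the entrywise conjugate of the basis `w, w'`, because `A = x w* + y w'*` involves the
  -- adjoints.
  obtain ⟨V, hV00, hV10, hV01, hV11⟩ := exists_unitary (w₀ := star (w 0)) (w₁ := star (w 1)) (e := 1)
    (by rw [star_star, star_star]; linear_combination hw) (by simp)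
  have hx' (i : Fin 2) : x i = φ (i, 0) * w 0 + φ (i, 1) * w 1 := by
    rw [hxdef, mulVec, dotProduct, Fin.sum_univ_two]; rfl
  have hy' (i : Fin 2) : y i = φ (i, 0) * -star (w 1) + φ (i, 1) * star (w 0) := by
    rw [hydef, mulVec, dotProduct, Fin.sum_univ_two]; rfl
  have hφ0 (i : Fin 2) : φ (i, 0) = x i * star (w 0) - y i * w 1 := by
    rw [hx', hy']; linear_combination -φ (i, 0) * hw
  have hφ1 (i : Fin 2) : φ (i, 1) = x i * star (w 1) + y i * w 0 := by
    rw [hx', hy']; linear_combination -φ (i, 1) * hw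
  refine ⟨U, V, c, d, hc.le, hd, ?_⟩
  ext ⟨i, j⟩
  rw [localAct_schmidtVec]
  fin_cases i <;> fin_cases j <;>
    simp only [Fin.zero_eta, Fin.mk_one, hφ0, hφ1, hU00, hU10, hU01, hU11, hV00, hV10, hV01, hV11,
      hu₀, hu₁, hy₀, hy₁, star_star] <;> ring

theorem continuous_localAct_schmidtVec (U V : M₂) :
    Continuous fun p : ℝ => localAct U V (schmidtVec √p √(1 - p)) := by
  refine (PiLp.continuous_toLp 2 _).comp (continuous_pi fun x => ?_)
  change Continuous fun p : ℝ => localAct U V (schmidtVec √p √(1 - p)) x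
  simp only [localAct_schmidtVec]
  fun_prop

/-- With `q = r / (1 - r)` the weights `q / (1 + q)` and `1 / (1 + q)` are `r` and `1 - r`. -/
theorem exists_phi_eq {r : ℚ} (h0 : (0 : ℝ) < r) (h1 : (r : ℝ) < 1) :
    ∃ q : PosRat, phi q = schmidtVec √(r : ℝ) √(1 - (r : ℝ)) := by
  have h0' : 0 < r := by exact_mod_cast h0
  have h1' : r < 1 := by exact_mod_cast h1
  refine ⟨⟨r / (1 - r), div_pos h0' (sub_pos.mpr h1')⟩, ?_⟩
  have hr : (1 - (r : ℝ)) ≠ 0 := (sub_pos.mpr h1).ne'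
  have e1 : (((r / (1 - r) : ℚ) : ℝ)) / (1 + ((r / (1 - r) : ℚ) : ℝ)) = r := by
    push_cast
    field_simp
    ring
  have e2 : 1 / (1 + ((r / (1 - r) : ℚ) : ℝ)) = 1 - r := by
    push_cast
    field_simp
    ring
  ext x
  rw [phi_apply, schmidtVec_apply, e1, e2]

theorem unit_subset_closure_targetStates : {φ : TwoQubit | ‖φ‖ = 1} ⊆ closure targetStates := by
  intro φ hφ
  rw [Set.mem_ofPred_eq] at hφ
  obtain ⟨U, V, c, d, hc, hd, rfl⟩ := exists_schmidt (φ := φ) (by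
    rintro rfl; rw [norm_zero] at hφ; exact zero_ne_one hφ)
  rw [norm_localAct] at hφ
  have hcd : c ^ 2 + d ^ 2 = 1 := by rw [← norm_schmidtVec_sq, hφ, one_pow]
  -- The weight `c ^ 2` may be the endpoint `0` or `1` (a product vector), but it is always a limit
  -- of rationals strictly between; continuity in the weight then gives the approximation with fixed
  -- `U` and `V`.
  have hmem : c ^ 2 ∈ closure (Set.Ioo (0 : ℝ) 1 ∩ Set.range ((↑) : ℚ → ℝ)) := by
    have h : closure (Set.Ioo (0 : ℝ) 1) ⊆
        closure (Set.Ioo (0 : ℝ) 1 ∩ Set.range ((↑) : ℚ → ℝ)) :=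
      closure_minimal (Rat.isDenseEmbedding_coe_real.dense.open_subset_closure_inter isOpen_Ioo)
        isClosed_closure
    refine h ?_
    rw [closure_Ioo zero_ne_one]
    exact ⟨sq_nonneg c, by nlinarith [sq_nonneg d]⟩
  have hval : localAct (U : M₂) (V : M₂) (schmidtVec c d) =
      (fun p : ℝ => localAct (U : M₂) (V : M₂) (schmidtVec √p √(1 - p))) (c ^ 2) := by
    have : 1 - c ^ 2 = d ^ 2 := by linarith
    simp only [this, Real.sqrt_sq hc, Real.sqrt_sq hd]
  rw [hval]
  refine closure_mono ?_ (image_closure_subset_closure_image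
    (continuous_localAct_schmidtVec (U : M₂) (V : M₂)) (Set.mem_image_of_mem _ hmem))
  rintro _ ⟨_, ⟨⟨h0, h1⟩, r, rfl⟩, rfl⟩
  obtain ⟨q, hq⟩ := exists_phi_eq h0 h1
  exact ⟨q, U, V, by rw [hq]⟩

end Targets

end CStarEmbezzlement

set_option maxHeartbeats 1000000 in
open CStarEmbezzlement in
theorem theorem1 :
    -- one catalyst state, the product over `q ∈ ℚ⁺` of the register states,
    ∃ (t : PosRat → MaxTensor CAR CAR →ₗ[ℂ] ℂ) (s : MaxTensor Registers Registers →ₗ[ℂ] ℂ),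
      (∀ q, IsRegisterState q (t q)) ∧ IsProductState t s ∧
      -- and, for each `q ∈ ℚ⁺`, the automorphism `α q`: swap and then shift register `q`,
      ∃ (σ : CAR ≃⋆ₐ[ℂ] CAR) (shift : PosRat → Registers ≃⋆ₐ[ℂ] Registers)
        (swap α : PosRat → MaxTensor Registers M₂ ≃⋆ₐ[ℂ] MaxTensor Registers M₂)
        (ρ : unitary M₂ → MaxTensor Registers M₂ ≃⋆ₐ[ℂ] MaxTensor Registers M₂),
        IsShift σ ∧ (∀ q, IsOnRegister q σ (shift q)) ∧ (∀ q, IsSwap q (swap q)) ∧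
        (∀ U, IsRotation U (ρ U)) ∧
        (∀ q x, α q x = tensorMap (shift q : Registers →⋆ₐ[ℂ] Registers)
          (StarAlgHom.id ℂ M₂) (swap q x)) ∧
        -- such that `α q ⊗ α q` embezzles `φ_q`,
        (∀ q, Embezzles s (α q) (α q) (phi q)) ∧
        -- and, with local unitaries applied to the outside qubits, every target state is embezzled;
        (∀ q U V, Embezzles s ((ρ U).trans (α q)) ((ρ V).trans (α q))
          (localAct (U : M₂) (V : M₂) (phi q))) ∧
        -- the target states are entangled, and they are dense among all two-qubit states.
        targetStates ⊆ entangledStates ∧ {φ : TwoQubit | ‖φ‖ = 1} ⊆ closure targetStates := by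
  choose t ht using exists_isRegisterState
  obtain ⟨s, h⟩ := exists_isProductState fun q => (ht q).1
  have hs := h.1
  have hsc := h.2
  obtain ⟨σ, hσ⟩ := exists_isShift
  choose shift hshift using fun q => exists_isOnRegister q σ
  choose swap hswap using exists_isSwap
  choose ρ hρ using exists_isRotation
  choose e he using fun q => exists_tensorEquiv (shift q) (StarAlgEquiv.refl ℂ M₂)
  let α : PosRat → MaxTensor Registers M₂ ≃⋆ₐ[ℂ] MaxTensor Registers M₂ :=
    fun q => (swap q).trans (e q)
  have hα (q x) : α q x = tensorMap (shift q : Registers →⋆ₐ[ℂ] Registers)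
      (StarAlgHom.id ℂ M₂) (swap q x) := he q _
  obtain ⟨S, h'⟩ := exists_state_tensor_vectorState hs.1 norm_ket00
  have hS := h'.1
  have hSc := h'.2.1
  have hSv := h'.2.2
  have hS₀ (a b m n) : S (tmul (tmul a m) (tmul b n)) = s (tmul a b) * (s₀ m * s₀ n) :=
    (hSv a b m n).trans (congrArg _ (vectorState_ket00 m n))
  have key (q a b m n) : S (tmul (α q (tmul a m)) (α q (tmul b n))) =
      s (tmul a b) * vectorState (phi q) m n :=
    embezzled_tmul ht hs hsc hSc hSv
      (swapShift_fullTensor hσ (hshift q) (hswap q) (hα q)) a b m n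
  refine ⟨t, s, ht, hs, σ, shift, swap, α, ρ, hσ, hshift, hswap, hρ, hα,
    fun q => embezzles_of_forall_tmul hS hS₀ (key q),
    fun q U V => embezzles_of_forall_tmul hS hS₀ fun a b m n => ?_,
    targetStates_subset_entangledStates, unit_subset_closure_targetStates⟩
  -- The rotations act before `α q` and only on `m` and `n`, so embezzlement of `φ_q` applies to the
  -- conjugated observables.
  have h : S (tmul (α q (ρ U (tmul a m))) (α q (ρ V (tmul b n)))) = _ :=
    (congrArg₂ (fun x y => S (tmul (α q x) (α q y))) (hρ U a m) (hρ V b n)).trans (key q a b _ _)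
  exact h.trans (congrArg _ (vectorState_localAct (U : M₂) (V : M₂) (phi q) m n).symm)
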